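/- Let $d\ge 1$ and order $\mathbb{N}^d$ componentwise, so $\mathbf{h}>\mathbf{k}$ means $\mathbf{h}\ge\mathbf{k}$ and $\mathbf{h}\neq\mathbf{k}$; "for all large $\mathbf{n}$" means for all $\mathbf{n}\ge\mathbf{n}_0$, for some $\mathbf{n}_0\in\mathbb{N}^d$. Let $A$ be an Artinian local ring with infinite residue field, $S=\bigoplus_{\mathbf{n}\in\mathbb{N}^d}S_{\mathbf{n}}$ a finitely generated standard $\mathbb{N}^d$-graded $A$-algebra (commutative, and generated over $A$ by $S_1\cup\dots\cup S_d$, where $S_i=S_{\mathbf{e}_i}$ is the component of degree the $i$-th unit vector $\mathbf{e}_i$), and $M=\bigoplus_{\mathbf{n}\in\mathbb{N}^d}M_{\mathbf{n}}$ a finitely generated $\mathbb{N}^d$-graded $S$-module. Let $P_M(\mathbf{n})$ be the Hilbert polynomial of $M$, i.e. the polynomial with $P_M(\mathbf{n})=\ell_A(M_{\mathbf{n}})$ for all large $\mathbf{n}$, and define the integers $e(M;\mathbf{k})$ by $$P_M(\mathbf{n})=\sum_{\mathbf{k}\in\mathbb{N}^d}e(M;\mathbf{k})\binom{\mathbf{n}+\mathbf{k}}{\mathbf{k}},\qquad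 \binom{\mathbf{n}+\mathbf{k}}{\mathbf{k}}=\prod_{i=1}^d\binom{n_i+k_i}{k_i}.$$ One says that $e(M;\mathbf{k})$ is the mixed multiplicity of $M$ of type $\mathbf{k}$ if $e(M;\mathbf{h})=0$ for all $\mathbf{h}>\mathbf{k}$. Let $S_{++}=\bigoplus_{\mathbf{n}\ge(1,\dots,1)}S_{\mathbf{n}}$, let $\mathrm{Proj}\,S$ be the set of homogeneous prime ideals of $S$ not containing $S_{++}$, and for an $S$-module $N$ put $\mathrm{Supp}_{++}N=\{P\in\mathrm{Proj}\,S : N_P\neq 0\}$; $\dim\mathrm{Supp}_{++}N$ is the supremum of the lengths of chains in $\mathrm{Supp}_{++}N$, and is $-\infty$ if $\mathrm{Supp}_{++}N=\emptyset$. A finite sequence $\mathbf{x}$ of elements of $S_1\cup\dots\cup S_d$ is of type $\mathbf{k}=(k_1,\dots,k_d)$ if it consists of $k_1$ elements of $S_1$, ..., $k_d$ elements of $S_d$ (in any order). A sequence $\mathbf{x}$ of type $\mathbf{k}$ is a mixed multiplicity system of $M$ of type $\mathbf{k}$ if $\dim\mathrm{Supp}_{++}(M/\mathbf{x}M)\le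 0$. A sequence $x_1,\dots,x_t$ of homogeneous elements of $S$ is $S_{++}$-filter-regular with respect to $M$ if for each $i$, with $N=M/(x_1,\dots,x_{i-1})M$, one has $(0_N:x_i)_{\mathbf{n}}=0$ for all large $\mathbf{n}$. Let $\mathbf{k}\in\mathbb{N}^d$ and assume that $e(M;\mathbf{k})$ is the mixed multiplicity of $M$ of type $\mathbf{k}$. Then the following are equivalent: (i) $e(M;\mathbf{k})>0$. (ii) $\dim\mathrm{Supp}_{++}(M/\mathbf{x}M)=0$ for every mixed multiplicity system $\mathbf{x}$ of $M$ of type $\mathbf{k}$. (iii) $\dim\mathrm{Supp}_{++}(M/\mathbf{x}M)=0$ for every $S_{++}$-filter-regular sequence $\mathbf{x}$ with respect to $M$ of type $\mathbf{k}$. (iv) There exists an $S_{++}$-filter-regular sequence $\mathbf{x}$ with respect to $M$ of type $\mathbf{k}$ such that $\dim\mathrm{Supp}_{++}(M/\mathbf{x}M)=0$. -/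

import Mathlib

open scoped BigOperators

namespace MixedMult

/-! `𝒮 : (Fin d → ℕ) → Submodule A S` is an `ℕ^d`-grading of the `A`-algebra `S`, and
`ℳ : (Fin d → ℕ) → Submodule A M` is an `ℕ^d`-grading of the `S`-module `M`. The order on
`Fin d → ℕ` is the componentwise one, so `∀ᶠ n in Filter.atTop` means
"for all `n ≥ n₀`, for some `n₀`", and `k < h` means `k ≤ h` and `k ≠ h`. -/

section Ring

variable {d : ℕ} {A S : Type*} [CommRing A] [CommRing S] [Algebra A S]

/-- `S` is a finitely generated standard `ℕ^d`-graded `A`-algebra: it is of finite type and is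
generated over `A` by its homogeneous elements of total degree `1`, i.e. by `S₁ ∪ … ∪ S_d`,
where `S_i` is the component of degree `e_i`. -/
def IsStandard (𝒮 : (Fin d → ℕ) → Submodule A S) : Prop :=
  Algebra.FiniteType A S ∧
    Algebra.adjoin A (⋃ i : Fin d, (𝒮 (Pi.single i 1) : Set S)) = ⊤

/-- The ideal `S_{++}`, the sum of the `S_n` over all `n ≥ (1, …, 1)`. -/
def plusPlus (𝒮 : (Fin d → ℕ) → Submodule A S) : Ideal S :=
  Ideal.span (⋃ n ∈ Set.Ici (1 : Fin d → ℕ), (𝒮 n : Set S))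

/-- `Proj S`: the homogeneous prime ideals of `S` that do not contain `S_{++}`. -/
def proj (𝒮 : (Fin d → ℕ) → Submodule A S) [GradedAlgebra 𝒮] : Set (PrimeSpectrum S) :=
  {P | P.asIdeal.IsHomogeneous 𝒮 ∧ ¬ plusPlus 𝒮 ≤ P.asIdeal}

/-- `Supp_{++} N`: the `P` in `Proj S` with `N_P ≠ 0`. -/
def suppPlusPlus (𝒮 : (Fin d → ℕ) → Submodule A S) [GradedAlgebra 𝒮]
    (N : Type*) [AddCommGroup N] [Module S N] : Set (PrimeSpectrum S) :=
  proj 𝒮 ∩ Module.support S N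

/-- `dim Supp_{++} N`: the supremum of the lengths of chains of primes in `Supp_{++} N`. It is
`⊥` (that is, `-∞`) when `Supp_{++} N` is empty. -/
noncomputable def dimSuppPlusPlus (𝒮 : (Fin d → ℕ) → Submodule A S) [GradedAlgebra 𝒮]
    (N : Type*) [AddCommGroup N] [Module S N] : WithBot ℕ∞ :=
  Order.krullDim (suppPlusPlus 𝒮 N)

/-- The sequence `x₁, …, x_t` is of type `k = (k₁, …, k_d)`: it consists of `k₁` elements of
`S₁`, …, `k_d` elements of `S_d` (in any order; `c j` is the index of the piece that `x j` is
counted in). -/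
def IsOfType (𝒮 : (Fin d → ℕ) → Submodule A S) {t : ℕ} (x : Fin t → S) (k : Fin d → ℕ) : Prop :=
  ∃ c : Fin t → Fin d, (∀ j, x j ∈ 𝒮 (Pi.single (c j) 1)) ∧
    ∀ i, (Finset.univ.filter fun j => c j = i).card = k i

end Ring

section Polynomial

variable {d : ℕ}

/-- The polynomial `binom(n + k, k) = ∏ i, binom(n_i + k_i, k_i)` in the variables `n_i`. -/
noncomputable def binomPoly (k : Fin d → ℕ) : MvPolynomial (Fin d) ℚ :=
  ∏ i, Polynomial.aeval (MvPolynomial.X i) (Polynomial.preHilbertPoly ℚ (k i) 0)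

/-- `P = ∑ k, e k * binom(n + k, k)` with integers `e k`, almost all zero. -/
def IsBinomialExpansion (P : MvPolynomial (Fin d) ℚ) (e : (Fin d → ℕ) →₀ ℤ) : Prop :=
  P = e.sum fun k c => (c : ℚ) • binomPoly k

end Polynomial

section Module

variable {d : ℕ} {A S M : Type*} [CommRing A] [CommRing S] [Algebra A S]
  [AddCommGroup M] [Module A M] [Module S M] [IsScalarTower A S M]

/-- `P(n) = ℓ_A(M_n)` for all large `n` (in particular these lengths are finite). -/
def IsHilbertPolynomial (ℳ : (Fin d → ℕ) → Submodule A M) (P : MvPolynomial (Fin d) ℚ) : Prop :=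
  ∀ᶠ n : Fin d → ℕ in Filter.atTop, ∃ l : ℕ,
    Module.length A (ℳ n) = (l : ℕ∞) ∧ MvPolynomial.eval (fun i => (n i : ℚ)) P = (l : ℚ)

open Classical in
/-- The Hilbert polynomial `P_M` of the Hilbert function `ℓ_A(M_n)`. -/
noncomputable def hilbertPolynomial (ℳ : (Fin d → ℕ) → Submodule A M) :
    MvPolynomial (Fin d) ℚ :=
  if h : ∃ P, IsHilbertPolynomial ℳ P then h.choose else 0

open Classical in
/-- The integers `e(M; k)` with `P_M(n) = ∑ k, e(M; k) * binom(n + k, k)`. -/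
noncomputable def hilbertCoeff (ℳ : (Fin d → ℕ) → Submodule A M) : (Fin d → ℕ) →₀ ℤ :=
  if h : ∃ e, IsBinomialExpansion (hilbertPolynomial ℳ) e then h.choose else 0

/-- `e(M; k)` is the mixed multiplicity (of maximal degree) of `M` of type `k`:
`e(M; h) = 0` for all `h > k`. -/
def IsMixedMultiplicity (ℳ : (Fin d → ℕ) → Submodule A M) (k : Fin d → ℕ) : Prop :=
  ∀ h : Fin d → ℕ, k < h → hilbertCoeff ℳ h = 0

/-- The grading of `M ⧸ N` whose degree `n` component is the image of `M_n`. -/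
def quotientGrading (ℳ : (Fin d → ℕ) → Submodule A M) (N : Submodule S M) :
    (Fin d → ℕ) → Submodule A (M ⧸ N) :=
  fun n => (ℳ n).map (N.mkQ.restrictScalars A)

/-- `a` is `S_{++}`-filter-regular with respect to `M`: `(0_M : a)_n = 0` for all large `n`. -/
def IsFilterRegular (ℳ : (Fin d → ℕ) → Submodule A M) (a : S) : Prop :=
  ∀ᶠ n : Fin d → ℕ in Filter.atTop, ∀ m ∈ ℳ n, a • m = 0 → m = 0

/-- `x₁, …, x_t` is an `S_{++}`-filter-regular sequence with respect to `M`: each `x_i` is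
`S_{++}`-filter-regular with respect to `M ⧸ (x₁, …, x_{i-1}) M`. -/
def IsFilterRegularSequence (ℳ : (Fin d → ℕ) → Submodule A M) {t : ℕ} (x : Fin t → S) : Prop :=
  ∀ i : Fin t, IsFilterRegular
    (quotientGrading ℳ (Ideal.span (x '' Set.Iio i) • (⊤ : Submodule S M))) (x i)

/-- The module `M / 𝐱M`. -/
abbrev ModSeq (M : Type*) [AddCommGroup M] [Module S M] {t : ℕ} (x : Fin t → S) : Type _ :=
  M ⧸ (Ideal.span (Set.range x) • (⊤ : Submodule S M))

/-- `x` is a mixed multiplicity system of `M` of type `k`. -/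
def IsMixedMultiplicitySystem (𝒮 : (Fin d → ℕ) → Submodule A S) [GradedAlgebra 𝒮]
    (M : Type*) [AddCommGroup M] [Module S M] {t : ℕ} (x : Fin t → S) (k : Fin d → ℕ) : Prop :=
  IsOfType 𝒮 x k ∧ dimSuppPlusPlus 𝒮 (ModSeq M x) ≤ 0

end Module

end MixedMult

/-! Everything rests on one observation: in the basis binom(n+k, k), the backward difference in
direction i merely translates the coefficients, `e ↦ shift (Pi.single i 1) e`. If x in S_i is
filter-regular on M, multiplication by x is injective in large degrees, so the Hilbert function of
M/xM is that backward difference for M. Hence, if e denotes the coefficients of M, M/𝐱M has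
coefficients `shift k e` for every filter-regular 𝐱 of type k
(`hasExpansion_quotient_of_isFilterRegularSequence`), and the vanishing of e(M; h) for h > k reduces
these to the constant e(M; k).

A module whose Hilbert function is eventually a constant c has dim Supp_{++} ≤ 0, with equality to 0
exactly when c > 0 (`dimSuppPlusPlus_of_hasExpansion_single`). A strict inclusion P < Q in the
support would make the lengths of the components of S/P unbounded, and the support is empty exactly
when the module vanishes in large degrees. So filter-regular sequences of type k are mixed
multiplicity systems, and the dimension of M/𝐱M detects the sign of e(M; k). Such sequences exist by
prime avoidance over the infinite residue field (`exists_isFilterRegularSequence`).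

A general mixed multiplicity system need not be filter-regular. For it,
`shift_eq_zero_of_forall_proj` shows that if Supp_{++}(M/𝐱M) is empty then `shift k e = 0`, so e(M;
k) = 0; the induction on the length of 𝐱 follows both the kernel and the cokernel of each
multiplication. -/

namespace MixedMult

set_option linter.unusedSectionVars false

/-! ### Binomial expansions and their differences. -/

section Combinatorics

variable {d : ℕ}

theorem single_le_of_ne_zero {a : Fin d → ℕ} {i : Fin d} (hi : a i ≠ 0) : Pi.single i 1 ≤ a := by
  intro j
  rcases eq_or_ne j i with rfl | hj
  · simpa using Nat.one_le_iff_ne_zero.2 hi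
  · simp [hj]

theorem vec_induction {p : (Fin d → ℕ) → Prop} (zero : p 0)
    (succ : ∀ a i, p a → p (a + Pi.single i 1)) (a : Fin d → ℕ) : p a := by
  induction hs : ∑ i, a i generalizing a with
  | zero =>
    have : a = 0 := by
      ext i
      simpa using (Finset.sum_eq_zero_iff.1 hs) i (Finset.mem_univ i)
    exact this ▸ zero
  | succ s ih =>
    obtain ⟨i, hi⟩ : ∃ i, a i ≠ 0 := by
      by_contra! h
      simp [h] at hs
    have hle : Pi.single i 1 ≤ a := single_le_of_ne_zero hi
    have ha : a = (a - Pi.single i 1) + Pi.single i 1 := (tsub_add_cancel_of_le hle).symm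
    rw [ha]
    refine succ _ _ (ih _ ?_)
    rw [ha] at hs
    simp only [Pi.add_apply, Finset.sum_add_distrib] at hs
    simpa using hs

theorem eventually_of_eventually_add {p : (Fin d → ℕ) → Prop} (a : Fin d → ℕ)
    (h : ∀ᶠ n in Filter.atTop, p (n + a)) : ∀ᶠ n in Filter.atTop, p n := by
  obtain ⟨n₀, h⟩ := Filter.eventually_atTop.1 h
  refine Filter.eventually_atTop.2 ⟨n₀ + a, fun n hn => ?_⟩
  have := h (n - a) (le_tsub_of_add_le_right hn)
  rwa [tsub_add_cancel_of_le (le_trans le_add_self hn)] at this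

theorem eventually_add {p : (Fin d → ℕ) → Prop} (a : Fin d → ℕ)
    (h : ∀ᶠ n in Filter.atTop, p n) : ∀ᶠ n in Filter.atTop, p (n + a) := by
  obtain ⟨n₀, h⟩ := Filter.eventually_atTop.1 h
  exact Filter.eventually_atTop.2 ⟨n₀, fun n hn => h _ (le_trans hn le_self_add)⟩

/-- The integer `binom(n + k, k)`. -/
def binomVal (k n : Fin d → ℕ) : ℤ := ∏ i, ((n i + k i).choose (k i) : ℤ)

/-- The value at `n` of the polynomial with binomial coefficients `e`. -/
noncomputable def binomSum (e : (Fin d → ℕ) →₀ ℤ) (n : Fin d → ℕ) : ℤ :=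
  e.sum fun k c => c * binomVal k n

/-- The function `h ↦ e (h + a)`. -/
noncomputable def shift (a : Fin d → ℕ) (e : (Fin d → ℕ) →₀ ℤ) : (Fin d → ℕ) →₀ ℤ :=
  e.comapDomain (· + a) (add_left_injective a).injOn

@[simp] theorem shift_apply (a : Fin d → ℕ) (e : (Fin d → ℕ) →₀ ℤ) (h : Fin d → ℕ) :
    shift a e h = e (h + a) := rfl

@[simp] theorem shift_zero_left (e : (Fin d → ℕ) →₀ ℤ) : shift 0 e = e := by
  ext; simp

theorem shift_shift (a b : Fin d → ℕ) (e : (Fin d → ℕ) →₀ ℤ) :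
    shift a (shift b e) = shift (a + b) e := by
  ext; simp [add_assoc]

theorem shift_add (a : Fin d → ℕ) (e f : (Fin d → ℕ) →₀ ℤ) :
    shift a (e + f) = shift a e + shift a f := by
  ext; simp

theorem shift_sub (a : Fin d → ℕ) (e f : (Fin d → ℕ) →₀ ℤ) :
    shift a (e - f) = shift a e - shift a f := by
  ext; simp

@[simp] theorem shift_zero_right (a : Fin d → ℕ) : shift a (0 : (Fin d → ℕ) →₀ ℤ) = 0 := by
  ext; simp

@[simp] theorem binomSum_zero (n : Fin d → ℕ) : binomSum 0 n = 0 := by simp [binomSum]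

theorem binomSum_add (e f : (Fin d → ℕ) →₀ ℤ) (n : Fin d → ℕ) :
    binomSum (e + f) n = binomSum e n + binomSum f n :=
  Finsupp.sum_add_index' (by simp) (by intros; ring)

theorem binomSum_sub (e f : (Fin d → ℕ) →₀ ℤ) (n : Fin d → ℕ) :
    binomSum (e - f) n = binomSum e n - binomSum f n :=
  Finsupp.sum_sub_index (by intros; ring)

theorem binomSum_single (k : Fin d → ℕ) (c : ℤ) (n : Fin d → ℕ) :
    binomSum (Finsupp.single k c) n = c * binomVal k n :=
  Finsupp.sum_single_index (by simp)

@[simp] theorem binomVal_zero (n : Fin d → ℕ) : binomVal 0 n = 1 := by simp [binomVal]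

theorem binomVal_add_single (k n : Fin d → ℕ) (i : Fin d) :
    binomVal (k + Pi.single i 1) (n + Pi.single i 1) =
      binomVal (k + Pi.single i 1) n + binomVal k (n + Pi.single i 1) := by
  unfold binomVal
  rw [← Finset.mul_prod_erase _ _ (Finset.mem_univ i), ← Finset.mul_prod_erase _ _ (Finset.mem_univ i),
    ← Finset.mul_prod_erase _ _ (Finset.mem_univ i)]
  have h1 : ∀ j ∈ Finset.univ.erase i,
      (((n + (Pi.single i 1 : Fin d → ℕ)) j + (k + (Pi.single i 1 : Fin d → ℕ)) j).choose ((k + (Pi.single i 1 : Fin d → ℕ)) j) : ℤ) =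
        ((n j + k j).choose (k j) : ℤ) := by
    intro j hj
    simp [(Finset.mem_erase.1 hj).1]
  have h2 : ∀ j ∈ Finset.univ.erase i,
      ((n j + (k + (Pi.single i 1 : Fin d → ℕ)) j).choose ((k + (Pi.single i 1 : Fin d → ℕ)) j) : ℤ) =
        ((n j + k j).choose (k j) : ℤ) := by
    intro j hj
    simp [(Finset.mem_erase.1 hj).1]
  have h3 : ∀ j ∈ Finset.univ.erase i,
      (((n + (Pi.single i 1 : Fin d → ℕ)) j + k j).choose (k j) : ℤ) =
        ((n j + k j).choose (k j) : ℤ) := by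
    intro j hj
    simp [(Finset.mem_erase.1 hj).1]
  rw [Finset.prod_congr rfl h1, Finset.prod_congr rfl h2, Finset.prod_congr rfl h3, ← add_mul]
  congr 1
  simp only [Pi.add_apply, Pi.single_eq_same]
  have : (n i + 1 + (k i + 1)).choose (k i + 1) =
      (n i + 1 + k i).choose (k i) + (n i + 1 + k i).choose (k i + 1) := by
    rw [← add_assoc, Nat.choose_succ_succ]
  rw [this, show n i + (k i + 1) = n i + 1 + k i by ring]
  push_cast
  ring

theorem binomVal_add_single_of_eq_zero (k n : Fin d → ℕ) (i : Fin d) (hk : k i = 0) :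
    binomVal k (n + Pi.single i 1) = binomVal k n := by
  unfold binomVal
  refine Finset.prod_congr rfl fun j _ => ?_
  rcases eq_or_ne j i with rfl | hj
  · simp [hk]
  · simp [hj]

/-- Pascal's rule in the i-th variable: differencing binom(n+k, k) lowers k_i by one, and gives zero
when k_i = 0. -/
theorem binomSum_add_single (e : (Fin d → ℕ) →₀ ℤ) (n : Fin d → ℕ) (i : Fin d) :
    binomSum e (n + Pi.single i 1) =
      binomSum e n + binomSum (shift (Pi.single i 1) e) (n + Pi.single i 1) := by
  induction e using Finsupp.induction_linear with
  | zero => simp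
  | add f g hf hg => rw [shift_add, binomSum_add, binomSum_add, binomSum_add, hf, hg]; ring
  | single k c =>
    by_cases hk : k i = 0
    · have : shift (Pi.single i 1) (Finsupp.single k c) = 0 := by
        ext h
        rw [shift_apply, Finsupp.single_apply, if_neg]
        · rfl
        · rintro rfl
          simp at hk
      rw [this, binomSum_zero, binomSum_single, binomSum_single,
        binomVal_add_single_of_eq_zero _ _ _ hk, add_zero]
    · obtain ⟨k, rfl⟩ : ∃ k', k = k' + Pi.single i 1 :=
        ⟨k - Pi.single i 1, (tsub_add_cancel_of_le (single_le_of_ne_zero hk)).symm⟩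
      have : shift (Pi.single i 1) (Finsupp.single (k + Pi.single i 1) c) = Finsupp.single k c := by
        ext h
        rw [shift_apply, Finsupp.single_apply, Finsupp.single_apply]
        simp only [add_left_inj]
      rw [this, binomSum_single, binomSum_single, binomSum_single, binomVal_add_single]
      ring

theorem eventually_binomSum_shift_eq_zero {e : (Fin d → ℕ) →₀ ℤ}
    (h : ∀ᶠ n in Filter.atTop, binomSum e n = 0) (a : Fin d → ℕ) :
    ∀ᶠ n in Filter.atTop, binomSum (shift a e) n = 0 := by
  induction a using vec_induction with
  | zero => simpa using h
  | succ a i ih =>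
    refine eventually_of_eventually_add (Pi.single i 1) ?_
    filter_upwards [ih, eventually_add (Pi.single i 1) ih] with n h1 h2
    rw [binomSum_add_single, h1, shift_shift, zero_add] at h2
    rwa [add_comm a]

theorem eq_zero_of_eventually_binomSum_eq_zero {e : (Fin d → ℕ) →₀ ℤ}
    (h : ∀ᶠ n in Filter.atTop, binomSum e n = 0) : e = 0 := by
  by_contra he
  -- Differencing down to an index maximal in the support leaves only the nonzero constant `e k`.
  obtain ⟨k, hk⟩ := e.support.exists_maximal (Finsupp.support_nonempty_iff.2 he)
  have hs : shift k e = Finsupp.single 0 (e k) := by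
    ext h
    rw [shift_apply, Finsupp.single_apply]
    split_ifs with h0
    · rw [← h0, zero_add]
    · by_contra hne
      have h1 := hk.le_of_ge (Finsupp.mem_support_iff.2 hne) (by simp)
      exact h0 (le_antisymm (by simp) (by simpa using h1))
  have h1 := eventually_binomSum_shift_eq_zero h k
  rw [hs] at h1
  obtain ⟨n, hn⟩ := h1.exists
  rw [binomSum_single] at hn
  exact Finsupp.mem_support_iff.1 hk.prop (by simpa using hn)

theorem eq_of_eventually_binomSum_eq {e f : (Fin d → ℕ) →₀ ℤ}
    (h : ∀ᶠ n in Filter.atTop, binomSum e n = binomSum f n) : e = f := by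
  refine sub_eq_zero.1 (eq_zero_of_eventually_binomSum_eq_zero ?_)
  filter_upwards [h] with n hn
  rw [binomSum_sub, hn, sub_self]

/-- Compatible families of shifts come from a single finitely supported function. -/
theorem exists_shift_eq (g : Fin d → (Fin d → ℕ) →₀ ℤ)
    (hg : ∀ i j, shift (Pi.single j 1) (g i) = shift (Pi.single i 1) (g j)) :
    ∃ e : (Fin d → ℕ) →₀ ℤ, ∀ i, shift (Pi.single i 1) e = g i := by
  classical
  -- The value at h ≠ 0 can be read off any `g i` with h_i ≠ 0, and `hg` makes the choice
  -- immaterial. The value at 0, the constant of integration, is free and set to 0.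
  let v : (Fin d → ℕ) → ℤ := fun h =>
    if hh : ∃ i, h i ≠ 0 then g hh.choose (h - Pi.single hh.choose 1) else 0
  have hv : ∀ i h, v (h + Pi.single i 1) = g i h := by
    intro i h
    have hh : ∃ j, (h + (Pi.single i 1 : Fin d → ℕ)) j ≠ 0 := ⟨i, by simp⟩
    simp only [v, dif_pos hh]
    have hj := hh.choose_spec
    generalize hh.choose = j at hj
    rcases eq_or_ne j i with rfl | hji
    · rw [add_tsub_cancel_right]
    · have hj' : h j ≠ 0 := by simpa [hji] using hj
      obtain ⟨l, rfl⟩ : ∃ l, h = l + Pi.single j 1 :=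
        ⟨h - Pi.single j 1, (tsub_add_cancel_of_le (single_le_of_ne_zero hj')).symm⟩
      rw [add_right_comm, add_tsub_cancel_right]
      exact DFunLike.congr_fun (hg j i) l
  refine ⟨Finsupp.onFinset (Finset.univ.biUnion fun i =>
    (g i).support.image (· + Pi.single i 1)) v ?_, fun i => ?_⟩
  · intro h hne
    have hh : ∃ i, h i ≠ 0 := by
      by_contra hh
      exact hne (by simp only [v, dif_neg hh])
    obtain ⟨i, hi⟩ := hh
    obtain ⟨l, rfl⟩ : ∃ l, h = l + Pi.single i 1 :=
      ⟨h - Pi.single i 1, (tsub_add_cancel_of_le (single_le_of_ne_zero hi)).symm⟩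
    rw [hv] at hne
    exact Finset.mem_biUnion.2 ⟨i, Finset.mem_univ i,
      Finset.mem_image.2 ⟨l, Finsupp.mem_support_iff.2 hne, rfl⟩⟩
  · ext h
    exact hv i h

/-- A function all of whose partial differences are eventually polynomial is eventually
polynomial. -/
theorem exists_binomSum_of_differences (f : (Fin d → ℕ) → ℤ) (g : Fin d → (Fin d → ℕ) →₀ ℤ)
    (hf : ∀ i, ∀ᶠ n in Filter.atTop,
      f (n + Pi.single i 1) = f n + binomSum (g i) (n + Pi.single i 1)) :
    ∃ e : (Fin d → ℕ) →₀ ℤ, ∀ᶠ n in Filter.atTop, f n = binomSum e n := by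
  -- Compatibility holds because the second differences of `f` in directions i and j do not depend
  -- on the order.
  obtain ⟨e, he⟩ := exists_shift_eq g (by
    intro i j
    refine eq_of_eventually_binomSum_eq ?_
    refine eventually_of_eventually_add (Pi.single i 1) ?_
    refine eventually_of_eventually_add (Pi.single j 1) ?_
    filter_upwards [hf i, hf j, eventually_add (Pi.single j 1) (hf i),
      eventually_add (Pi.single i 1) (hf j)] with n h1 h2 h3 h4
    have h5 := binomSum_add_single (g i) (n + Pi.single i 1) j
    have h6 := binomSum_add_single (g j) (n + Pi.single j 1) i
    rw [add_right_comm n (Pi.single j 1) (Pi.single i 1)] at h3 h6 ⊢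
    linarith)
  have hall : ∀ᶠ n in Filter.atTop, ∀ i,
      f (n + Pi.single i 1) - binomSum e (n + Pi.single i 1) = f n - binomSum e n := by
    rw [Filter.eventually_all]
    intro i
    filter_upwards [hf i] with n hn
    rw [hn, binomSum_add_single e, he i]
    ring
  obtain ⟨n₀, hn₀⟩ := Filter.eventually_atTop.1 hall
  -- Beyond `n₀` no unit step changes f - `binomSum e`; its constant value is then added to the
  -- coefficient at index 0.
  have hconst : ∀ a, f (n₀ + a) - binomSum e (n₀ + a) = f n₀ - binomSum e n₀ := by
    intro a
    induction a using vec_induction with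
    | zero => simp
    | succ a i ih => rw [← add_assoc, hn₀ _ le_self_add i, ih]
  refine ⟨e + Finsupp.single 0 (f n₀ - binomSum e n₀),
    Filter.eventually_atTop.2 ⟨n₀, fun n hn => ?_⟩⟩
  have := hconst (n - n₀)
  rw [add_tsub_cancel_of_le hn] at this
  rw [binomSum_add, binomSum_single, binomVal_zero]
  linarith

theorem eval_binomPoly (k n : Fin d → ℕ) :
    MvPolynomial.eval (fun i => (n i : ℚ)) (binomPoly k) = (binomVal k n : ℚ) := by
  unfold binomPoly binomVal
  rw [map_prod]
  push_cast
  refine Finset.prod_congr rfl fun i _ => ?_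
  rw [Polynomial.aeval_def, Polynomial.hom_eval₂]
  have h := Polynomial.preHilbertPoly_eq_choose_sub_add ℚ (k i) (Nat.zero_le (n i))
  rw [tsub_zero] at h
  rw [← h, MvPolynomial.eval_X, Polynomial.eval]
  congr 1
  exact Subsingleton.elim _ _

theorem eval_binomial_expansion (e : (Fin d → ℕ) →₀ ℤ) (n : Fin d → ℕ) :
    MvPolynomial.eval (fun i => (n i : ℚ)) (e.sum fun k c => (c : ℚ) • binomPoly k) =
      (binomSum e n : ℚ) := by
  unfold binomSum Finsupp.sum
  rw [map_sum]
  push_cast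
  refine Finset.sum_congr rfl fun k _ => ?_
  rw [MvPolynomial.smul_eval, eval_binomPoly]

theorem eq_of_eventually_eval_eq {P Q : MvPolynomial (Fin d) ℚ}
    (h : ∀ᶠ n : Fin d → ℕ in Filter.atTop,
      MvPolynomial.eval (fun i => (n i : ℚ)) P = MvPolynomial.eval (fun i => (n i : ℚ)) Q) :
    P = Q := by
  obtain ⟨n₀, h⟩ := Filter.eventually_atTop.1 h
  refine MvPolynomial.funext_set (fun i => (fun m : ℕ => (m : ℚ)) '' Set.Ici (n₀ i))
    (fun i => (Set.Ici_infinite _).image Nat.cast_injective.injOn) fun x hx => ?_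
  choose m hm hmx using fun i => hx i (Set.mem_univ i)
  have := h m hm
  simpa [hmx] using this

end Combinatorics

/-! ### Projections to homogeneous components. -/

section Component

variable {d : ℕ} {A M : Type*} [CommRing A] [AddCommGroup M] [Module A M]
  (ℳ : (Fin d → ℕ) → Submodule A M)

/-- A family of submodules spanning `M` which admits a compatible family of projections is a
direct sum decomposition. -/
theorem isInternal_of_projections (p : (Fin d → ℕ) → M →ₗ[A] M)
    (h1 : ∀ n, ∀ m ∈ ℳ n, p n m = m) (h0 : ∀ n k, k ≠ n → ∀ m ∈ ℳ k, p n m = 0)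
    (htop : ⨆ n, ℳ n = ⊤) : DirectSum.IsInternal ℳ := by
  constructor
  · have key : ∀ n, p n ∘ₗ DirectSum.coeLinearMap ℳ =
        (ℳ n).subtype ∘ₗ DirectSum.component A _ _ n := by
      intro n
      refine DirectSum.linearMap_ext _ fun k => ?_
      ext m
      simp only [LinearMap.comp_apply, DirectSum.coeLinearMap_lof]
      rcases eq_or_ne k n with rfl | hk
      · rw [DirectSum.component.lof_self, h1 _ _ m.2, Submodule.subtype_apply]
      · rw [h0 n k hk _ m.2, DirectSum.component.of, dif_neg hk, map_zero]
    intro f g hfg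
    refine DirectSum.ext_component A fun n => Subtype.ext ?_
    have hf := LinearMap.congr_fun (key n) f
    have hg := LinearMap.congr_fun (key n) g
    simp only [LinearMap.comp_apply, Submodule.subtype_apply] at hf hg
    rw [← hf, ← hg]
    exact congrArg _ hfg
  · have := DirectSum.range_coeLinearMap (A := ℳ)
    rw [htop] at this
    exact LinearMap.range_eq_top.1 this

variable [DirectSum.Decomposition ℳ]

/-- The projection of `M` to its component of degree `n`. -/
def comp (n : Fin d → ℕ) : M →ₗ[A] M :=
  (ℳ n).subtype ∘ₗ DirectSum.component A _ _ n ∘ₗ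
    (DirectSum.decomposeLinearEquiv ℳ).toLinearMap

theorem comp_apply (n : Fin d → ℕ) (m : M) : comp ℳ n m = DirectSum.decompose ℳ m n := rfl

theorem comp_mem (n : Fin d → ℕ) (m : M) : comp ℳ n m ∈ ℳ n := (DirectSum.decompose ℳ m n).2

variable {ℳ} in
theorem comp_of_mem {n : Fin d → ℕ} {m : M} (hm : m ∈ ℳ n) : comp ℳ n m = m :=
  DirectSum.decompose_of_mem_same ℳ hm

variable {ℳ} in
theorem comp_of_mem_ne {n k : Fin d → ℕ} {m : M} (hm : m ∈ ℳ k) (h : k ≠ n) : comp ℳ n m = 0 :=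
  DirectSum.decompose_of_mem_ne ℳ hm h

theorem mem_of_comp_mem {N : AddSubmonoid M} {m : M} (h : ∀ n, comp ℳ n m ∈ N) : m ∈ N := by
  classical
  rw [← DirectSum.sum_support_decompose ℳ m]
  exact sum_mem fun n _ => h n

theorem iSup_eq_top : ⨆ n, ℳ n = ⊤ :=
  eq_top_iff.2 fun m _ => mem_of_comp_mem ℳ (N := (⨆ n, ℳ n).toAddSubmonoid)
    fun n => Submodule.mem_iSup_of_mem n (comp_mem ℳ n m)

end Component

/-! ### Homogeneous submodules and the induced gradings. -/

section Graded

variable {d : ℕ} {A S M : Type*} [CommRing A] [CommRing S] [Algebra A S]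
  (𝒮 : (Fin d → ℕ) → Submodule A S) [GradedAlgebra 𝒮]
  [AddCommGroup M] [Module A M] [Module S M] [IsScalarTower A S M]
  (ℳ : (Fin d → ℕ) → Submodule A M) [DirectSum.Decomposition ℳ] [SetLike.GradedSMul 𝒮 ℳ]

variable {𝒮 ℳ} in
theorem smul_mem_add {a n : Fin d → ℕ} {r : S} {m : M} (hr : r ∈ 𝒮 a) (hm : m ∈ ℳ n) :
    r • m ∈ ℳ (a + n) := SetLike.GradedSMul.smul_mem hr hm

variable {𝒮} in
theorem comp_smul_of_mem_left {a : Fin d → ℕ} {r : S} (hr : r ∈ 𝒮 a) (n : Fin d → ℕ) (m : M) :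
    comp ℳ (a + n) (r • m) = r • comp ℳ n m := by
  induction m using DirectSum.Decomposition.inductionOn ℳ with
  | zero => simp
  | add m m' hm hm' => rw [smul_add, map_add, map_add, smul_add, hm, hm']
  | @homogeneous k m =>
    rcases eq_or_ne k n with rfl | hk
    · rw [comp_of_mem (smul_mem_add hr m.2), comp_of_mem m.2]
    · rw [comp_of_mem_ne m.2 hk, comp_of_mem_ne (smul_mem_add hr m.2) (by simpa using hk),
        smul_zero]

variable {𝒮} in
theorem comp_smul_of_not_le {a n : Fin d → ℕ} {r : S} (hr : r ∈ 𝒮 a) (h : ¬ a ≤ n) (m : M) :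
    comp ℳ n (r • m) = 0 := by
  induction m using DirectSum.Decomposition.inductionOn ℳ with
  | zero => simp
  | add m m' hm hm' => rw [smul_add, map_add, hm, hm', add_zero]
  | @homogeneous k m =>
    refine comp_of_mem_ne (smul_mem_add hr m.2) ?_
    rintro rfl
    exact h le_self_add

theorem comp_smul_of_mem_right {n : Fin d → ℕ} {m : M} (hm : m ∈ ℳ n) (a : Fin d → ℕ) (r : S) :
    comp ℳ (a + n) (r • m) = comp 𝒮 a r • m := by
  induction r using DirectSum.Decomposition.inductionOn 𝒮 with
  | zero => simp
  | add r r' hr hr' => rw [add_smul, map_add, map_add, add_smul, hr, hr']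
  | @homogeneous b r =>
    rcases eq_or_ne b a with rfl | hb
    · rw [comp_of_mem (smul_mem_add r.2 hm), comp_of_mem r.2]
    · rw [comp_of_mem_ne r.2 hb, comp_of_mem_ne (smul_mem_add r.2 hm) (by simpa using hb),
        zero_smul]

variable {𝒮 ℳ} in
theorem isHomogeneous_ker_smul {a : Fin d → ℕ} {x : S} (hx : x ∈ 𝒮 a) :
    (LinearMap.ker (LinearMap.lsmul S M x)).IsHomogeneous ℳ := by
  intro n m hm
  rw [LinearMap.mem_ker, LinearMap.lsmul_apply] at hm ⊢
  rw [← comp_apply, ← comp_smul_of_mem_left ℳ hx, hm, map_zero]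

theorem isHomogeneous_annihilator (ℳ : (Fin d → ℕ) → Submodule A M)
    [DirectSum.Decomposition ℳ] [SetLike.GradedSMul 𝒮 ℳ] :
    (Module.annihilator S M).IsHomogeneous 𝒮 := by
  intro a r hr
  rw [Module.mem_annihilator] at hr ⊢
  intro m
  induction m using DirectSum.Decomposition.inductionOn ℳ with
  | zero => simp
  | add m m' hm hm' => rw [smul_add, hm, hm', add_zero]
  | @homogeneous k m =>
    rw [← comp_apply, ← comp_smul_of_mem_right 𝒮 ℳ m.2, hr, map_zero]

theorem isHomogeneous_smul_top {I : Ideal S} (hI : I.IsHomogeneous 𝒮) :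
    (I • (⊤ : Submodule S M)).IsHomogeneous ℳ := by
  intro n z hz
  rw [← comp_apply]
  induction hz using Submodule.smul_induction_on' with
  | add x _ y _ hx hy => rw [map_add]; exact add_mem hx hy
  | smul r hr m _ =>
    -- For fixed `m` the condition on `r` is additive, so it suffices to check the homogeneous
    -- components of `r`, which lie in `I`.
    have : r ∈ (AddSubmonoid.comap ((comp ℳ n).toAddMonoidHom.comp
        ((LinearMap.toSpanSingleton S M m).toAddMonoidHom))
        (I • (⊤ : Submodule S M)).toAddSubmonoid) := by
      refine mem_of_comp_mem 𝒮 fun a => ?_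
      change comp ℳ n (comp 𝒮 a r • m) ∈ I • (⊤ : Submodule S M)
      by_cases ha : a ≤ n
      · obtain ⟨b, rfl⟩ := exists_add_of_le ha
        rw [comp_smul_of_mem_left ℳ (comp_mem 𝒮 a r)]
        exact Submodule.smul_mem_smul (hI a hr) trivial
      · rw [comp_smul_of_not_le ℳ (comp_mem 𝒮 a r) ha]
        exact zero_mem _
    exact this

variable {ℳ} in
theorem isHomogeneous_sup {N N' : Submodule S M} (hN : N.IsHomogeneous ℳ)
    (hN' : N'.IsHomogeneous ℳ) : (N ⊔ N').IsHomogeneous ℳ := by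
  intro n m hm
  obtain ⟨y, hy, z, hz, rfl⟩ := Submodule.mem_sup.1 hm
  rw [← comp_apply, map_add]
  exact Submodule.add_mem_sup (hN n hy) (hN' n hz)

theorem exists_homogeneous_generators [Module.Finite S M] :
    ∃ s : Finset M, (∀ m ∈ s, ∃ n, m ∈ ℳ n) ∧ Submodule.span S (s : Set M) = ⊤ := by
  have h : Submodule.span S (⋃ n, (ℳ n : Set M)) = ⊤ := by
    refine eq_top_iff.2 fun m _ => mem_of_comp_mem ℳ
      (N := (Submodule.span S (⋃ n, (ℳ n : Set M))).toAddSubmonoid) fun n => ?_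
    exact Submodule.subset_span (Set.mem_iUnion.2 ⟨n, comp_mem ℳ n m⟩)
  obtain ⟨s, hs, hs'⟩ := (Submodule.fg_span_iff_fg_span_finset_subset _).1
    (h ▸ Module.Finite.fg_top : (Submodule.span S (⋃ n, (ℳ n : Set M))).FG)
  exact ⟨s, fun m hm => Set.mem_iUnion.1 (hs hm), hs' ▸ h⟩

/-- The grading induced on a submodule. -/
def subGrading (ℳ : (Fin d → ℕ) → Submodule A M) (N : Submodule S M) :
    (Fin d → ℕ) → Submodule A N :=
  fun n => (ℳ n).comap (N.subtype.restrictScalars A)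

theorem mem_subGrading {ℳ : (Fin d → ℕ) → Submodule A M} {N : Submodule S M} {n : Fin d → ℕ}
    {m : N} : m ∈ subGrading ℳ N n ↔ (m : M) ∈ ℳ n := Iff.rfl

instance subGrading_gradedSMul (N : Submodule S M) :
    SetLike.GradedSMul 𝒮 (subGrading ℳ N) where
  smul_mem _ _ _ _ hr hm := smul_mem_add (ℳ := ℳ) hr (mem_subGrading.1 hm)

instance quotientGrading_gradedSMul (N : Submodule S M) :
    SetLike.GradedSMul 𝒮 (quotientGrading ℳ N) where
  smul_mem := by
    rintro a n r _ hr ⟨m, hm, rfl⟩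
    exact ⟨r • m, smul_mem_add hr hm, rfl⟩

variable {ℳ} in
theorem isInternal_subGrading {N : Submodule S M} (hN : N.IsHomogeneous ℳ) :
    DirectSum.IsInternal (subGrading ℳ N) := by
  refine isInternal_of_projections _
    (fun n => ((comp ℳ n).restrict (p := N.restrictScalars A) (q := N.restrictScalars A)
      fun m hm => hN n hm : N.restrictScalars A →ₗ[A] N.restrictScalars A)) ?_ ?_ ?_
  · intro n m hm
    exact Subtype.ext (comp_of_mem (mem_subGrading.1 hm))
  · intro n k hk m hm
    exact Subtype.ext (comp_of_mem_ne (mem_subGrading.1 hm) hk)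
  · classical
    refine eq_top_iff.2 fun m _ => ?_
    have : m = ∑ n ∈ (DirectSum.decompose ℳ (m : M)).support,
        (⟨comp ℳ n m, hN n m.2⟩ : N) := by
      refine Subtype.ext ?_
      rw [Submodule.coe_sum]
      exact (DirectSum.sum_support_decompose ℳ (m : M)).symm
    rw [this]
    exact sum_mem fun n _ => Submodule.mem_iSup_of_mem n (mem_subGrading.2 (comp_mem ℳ n m))

variable {ℳ} in
theorem isInternal_quotientGrading {N : Submodule S M} (hN : N.IsHomogeneous ℳ) :
    DirectSum.IsInternal (quotientGrading ℳ N) := by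
  refine isInternal_of_projections _
    (fun n => (Submodule.Quotient.restrictScalarsEquiv A N).toLinearMap ∘ₗ
      (Submodule.mapQ (N.restrictScalars A) (N.restrictScalars A) (comp ℳ n)
        fun m hm => hN n hm) ∘ₗ (Submodule.Quotient.restrictScalarsEquiv A N).symm.toLinearMap)
      ?_ ?_ ?_
  · rintro n _ ⟨m, hm, rfl⟩
    change Submodule.Quotient.mk (comp ℳ n m) = _
    rw [comp_of_mem hm]
    rfl
  · rintro n k hk _ ⟨m, hm, rfl⟩
    change Submodule.Quotient.mk (comp ℳ n m) = _
    rw [comp_of_mem_ne hm hk]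
    rfl
  · unfold quotientGrading
    rw [← Submodule.map_iSup, iSup_eq_top, Submodule.map_top, LinearMap.range_eq_top]
    exact N.mkQ_surjective

variable {ℳ} in
/-- The decomposition of a homogeneous submodule. -/
@[reducible] noncomputable def subDecomposition {N : Submodule S M} (hN : N.IsHomogeneous ℳ) :
    DirectSum.Decomposition (subGrading ℳ N) :=
  (isInternal_subGrading hN).chooseDecomposition

variable {ℳ} in
/-- The decomposition of the quotient by a homogeneous submodule. -/
@[reducible] noncomputable def quotientDecomposition {N : Submodule S M}
    (hN : N.IsHomogeneous ℳ) : DirectSum.Decomposition (quotientGrading ℳ N) :=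
  (isInternal_quotientGrading hN).chooseDecomposition

end Graded

/-! ### Standard gradings, S_{++} and homogeneous primes. -/

section Standard

variable {d : ℕ} {A S : Type*} [CommRing A] [CommRing S] [Algebra A S]
  (𝒮 : (Fin d → ℕ) → Submodule A S)

/-- The ideal generated by the component of degree the `i`-th unit vector. -/
def degIdeal (i : Fin d) : Ideal S := Ideal.span (𝒮 (Pi.single i 1) : Set S)

/-- The product of the `n i`-th powers of the ideals `degIdeal 𝒮 i`. -/
def degProd (n : Fin d → ℕ) : Ideal S := ∏ i, degIdeal 𝒮 i ^ n i

theorem degProd_add (m n : Fin d → ℕ) : degProd 𝒮 (m + n) = degProd 𝒮 m * degProd 𝒮 n := by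
  simp only [degProd, Pi.add_apply, pow_add, Finset.prod_mul_distrib]

theorem degProd_zero : degProd 𝒮 0 = ⊤ := by
  simp [degProd]

theorem degProd_single (i : Fin d) : degProd 𝒮 (Pi.single i 1) = degIdeal 𝒮 i := by
  unfold degProd
  rw [Finset.prod_eq_single i]
  · simp
  · intro j _ hj
    simp [hj]
  · simp

theorem degProd_anti {m n : Fin d → ℕ} (h : m ≤ n) : degProd 𝒮 n ≤ degProd 𝒮 m := by
  obtain ⟨k, rfl⟩ := exists_add_of_le h
  rw [degProd_add]
  exact Ideal.mul_le_left

theorem degProd_one_pow (c : ℕ) : degProd 𝒮 1 ^ c = degProd 𝒮 fun _ => c := by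
  simp [degProd, Finset.prod_pow]

variable [GradedAlgebra 𝒮]

theorem prod_mem_one {x : Fin d → S} (hx : ∀ i, x i ∈ 𝒮 (Pi.single i 1)) :
    ∏ i, x i ∈ 𝒮 1 := by
  have h := SetLike.prod_mem_graded 𝒮 (fun i => Pi.single i 1) x (F := Finset.univ)
    fun i _ => hx i
  have h1 : ∑ i : Fin d, (Pi.single i 1 : Fin d → ℕ) = 1 :=
    Finset.univ_sum_single (1 : Fin d → ℕ)
  rwa [h1] at h

theorem prod_pow_mem {x : Fin d → S} (hx : ∀ i, x i ∈ 𝒮 (Pi.single i 1)) (n : Fin d → ℕ) :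
    ∏ i, x i ^ n i ∈ 𝒮 n := by
  have h := SetLike.prod_mem_graded 𝒮 (fun i => n i • Pi.single i 1) (fun i => x i ^ n i)
    (F := Finset.univ) fun i _ => SetLike.pow_mem_graded (n i) (hx i)
  have h1 : ∑ i : Fin d, n i • (Pi.single i 1 : Fin d → ℕ) = n := by
    conv_rhs => rw [← Finset.univ_sum_single n]
    refine Finset.sum_congr rfl fun i _ => ?_
    rw [← Pi.single_smul, smul_eq_mul, mul_one]
  rwa [h1] at h

theorem mem_plusPlus {n : Fin d → ℕ} (hn : 1 ≤ n) {x : S} (hx : x ∈ 𝒮 n) : x ∈ plusPlus 𝒮 :=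
  Ideal.subset_span (Set.mem_biUnion (Set.mem_Ici.2 hn) hx)

theorem degProd_one_le_plusPlus : degProd 𝒮 1 ≤ plusPlus 𝒮 := by
  unfold degProd degIdeal
  simp only [Pi.one_apply, pow_one]
  rw [Ideal.prod_span, Ideal.span_le]
  intro x hx
  obtain ⟨g, hg, rfl⟩ := (Set.mem_finsetProd _ _ _).1 hx
  exact mem_plusPlus 𝒮 le_rfl (prod_mem_one 𝒮 fun i => hg (Finset.mem_univ i))

/-- A prime ideal not containing `S_{++}` misses an element of each of `S₁, …, S_d`. -/
theorem exists_mem_notMem_of_not_plusPlus_le {𝒮 : (Fin d → ℕ) → Submodule A S} [GradedAlgebra 𝒮]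
    (hplus : plusPlus 𝒮 ≤ degProd 𝒮 1) {P : Ideal S} (hP : ¬ plusPlus 𝒮 ≤ P) (i : Fin d) :
    ∃ x ∈ 𝒮 (Pi.single i 1), x ∉ P := by
  by_contra! h
  refine hP (hplus.trans ((degProd_anti 𝒮 (m := Pi.single i 1) ?_).trans ?_))
  · exact single_le_of_ne_zero (by simp)
  · rw [degProd_single]
    exact Ideal.span_le.2 h

variable {𝒮}

theorem mem_closure_homogeneous {y : S}
    (hy : y ∈ Submonoid.closure (⋃ i : Fin d, (𝒮 (Pi.single i 1) : Set S))) :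
    ∃ n, y ∈ 𝒮 n ∧ y ∈ degProd 𝒮 n ∧ (n = 0 → y = 1) := by
  induction hy using Submonoid.closure_induction with
  | mem y hy =>
    obtain ⟨i, hi⟩ := Set.mem_iUnion.1 hy
    refine ⟨Pi.single i 1, hi, ?_, ?_⟩
    · rw [degProd_single]
      exact Ideal.subset_span hi
    · intro h
      simpa using congrFun h i
  | one => exact ⟨0, SetLike.GradedOne.one_mem, by simp [degProd_zero], fun _ => rfl⟩
  | mul y z _ _ hy hz =>
    obtain ⟨n, h1, h2, h3⟩ := hy
    obtain ⟨m, h4, h5, h6⟩ := hz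
    refine ⟨n + m, SetLike.GradedMul.mul_mem h1 h4, ?_, fun h => ?_⟩
    · rw [degProd_add]
      exact Ideal.mul_mem_mul h2 h5
    · obtain ⟨hn, hm⟩ := add_eq_zero.1 h
      rw [h3 hn, h6 hm, one_mul]

theorem mem_span_closure (hS : IsStandard 𝒮) (s : S) : s ∈ Submodule.span A
    (Submonoid.closure (⋃ i : Fin d, (𝒮 (Pi.single i 1) : Set S)) : Set S) := by
  rw [← Algebra.adjoin_eq_span, hS.2]
  trivial

/-- By standardness, an element of degree n is an A-combination of products with exactly n_i factors
from each S_i. -/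
theorem comp_mem_degProd (hS : IsStandard 𝒮) (n : Fin d → ℕ) (s : S) :
    comp 𝒮 n s ∈ degProd 𝒮 n := by
  induction mem_span_closure hS s using Submodule.span_induction with
  | mem y hy =>
    obtain ⟨k, h1, h2, -⟩ := mem_closure_homogeneous hy
    rcases eq_or_ne k n with rfl | hk
    · rwa [comp_of_mem h1]
    · rw [comp_of_mem_ne h1 hk]
      exact zero_mem _
  | zero => simp
  | add x y _ _ hx hy => rw [map_add]; exact add_mem hx hy
  | smul a x _ hx => rw [map_smul]; exact Submodule.smul_of_tower_mem _ a hx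

theorem mem_degProd (hS : IsStandard 𝒮) {n : Fin d → ℕ} {s : S} (hs : s ∈ 𝒮 n) :
    s ∈ degProd 𝒮 n := by
  simpa [comp_of_mem hs] using comp_mem_degProd hS n s

theorem plusPlus_le_degProd_one (hS : IsStandard 𝒮) : plusPlus 𝒮 ≤ degProd 𝒮 1 := by
  refine Ideal.span_le.2 fun x hx => ?_
  obtain ⟨n, hn, hx⟩ := Set.mem_iUnion₂.1 hx
  exact degProd_anti 𝒮 hn (mem_degProd hS hx)

/-- A product of generators has degree 0 only when it is empty, so S_0 is the image of A. -/
theorem exists_algebraMap_eq_comp_zero (hS : IsStandard 𝒮) (s : S) :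
    ∃ a, algebraMap A S a = comp 𝒮 0 s := by
  induction mem_span_closure hS s using Submodule.span_induction with
  | mem y hy =>
    obtain ⟨k, h1, -, h2⟩ := mem_closure_homogeneous hy
    rcases eq_or_ne k 0 with rfl | hk
    · exact ⟨1, by rw [comp_of_mem h1, h2 rfl, map_one]⟩
    · exact ⟨0, by rw [comp_of_mem_ne h1 hk, map_zero]⟩
  | zero => exact ⟨0, by simp⟩
  | add x y _ _ hx hy =>
    obtain ⟨a, ha⟩ := hx
    obtain ⟨b, hb⟩ := hy
    exact ⟨a + b, by rw [map_add, map_add, ha, hb]⟩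
  | smul a x _ hx =>
    obtain ⟨b, hb⟩ := hx
    exact ⟨a * b, by rw [map_smul, ← hb, map_mul, Algebra.smul_def]⟩

section Regrading

variable {ι : Type*} [AddCommMonoid ι] (𝒮) (e : ι ≃+ (Fin d → ℕ))

/-- The grading by a monoid isomorphic to `ℕ^d`. -/
def regrading (n : ι) : Submodule A S := 𝒮 (e n)

theorem isInternal_regrading [DecidableEq ι] : DirectSum.IsInternal (regrading 𝒮 e) := by
  have h := (DirectSum.isInternal_submodule_iff_iSupIndep_and_iSup_eq_top _).1
    (DirectSum.Decomposition.isInternal 𝒮)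
  refine (DirectSum.isInternal_submodule_iff_iSupIndep_and_iSup_eq_top _).2
    ⟨h.1.comp e.injective, ?_⟩
  rw [← h.2]
  exact e.surjective.iSup_comp 𝒮

instance regrading_gradedMonoid : SetLike.GradedMonoid (regrading 𝒮 e) where
  one_mem := by
    unfold regrading
    rw [map_zero]
    exact SetLike.GradedOne.one_mem
  mul_mem _ _ _ _ hx hy := by
    unfold regrading
    rw [map_add]
    exact SetLike.GradedMul.mul_mem hx hy

noncomputable instance regrading_gradedRing [DecidableEq ι] : GradedRing (regrading 𝒮 e) where
  toDecomposition := (isInternal_regrading 𝒮 e).chooseDecomposition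

theorem decompose_regrading [DecidableEq ι] (n : ι) (r : S) :
    (DirectSum.decompose (regrading 𝒮 e) r n : S) = DirectSum.decompose 𝒮 r (e n) := by
  induction r using DirectSum.Decomposition.inductionOn 𝒮 with
  | zero => simp
  | add x y hx hy =>
    rw [DirectSum.decompose_add, DirectSum.decompose_add, DirectSum.add_apply, DirectSum.add_apply,
      Submodule.coe_add, Submodule.coe_add, hx, hy]
  | @homogeneous k x =>
    obtain ⟨k, rfl⟩ := e.surjective k
    have hx : (x : S) ∈ regrading 𝒮 e k := x.2
    rcases eq_or_ne k n with rfl | hk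
    · rw [DirectSum.decompose_of_mem_same 𝒮 x.2, DirectSum.decompose_of_mem_same _ hx]
    · rw [DirectSum.decompose_of_mem_ne 𝒮 x.2 (e.injective.ne hk),
        DirectSum.decompose_of_mem_ne _ hx hk]

theorem isHomogeneous_regrading_iff [DecidableEq ι] {I : Ideal S} :
    I.IsHomogeneous (regrading 𝒮 e) ↔ I.IsHomogeneous 𝒮 := by
  constructor
  · intro h n r hr
    obtain ⟨k, rfl⟩ := e.surjective n
    have := h k hr
    rwa [decompose_regrading] at this
  · intro h n r hr
    rw [decompose_regrading]
    exact h (e n) hr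

variable {𝒮} in
theorem radical_eq_of_regrading [LinearOrder ι] [IsOrderedCancelAddMonoid ι]
    (e : ι ≃+ (Fin d → ℕ)) {I : Ideal S}
    (hI : I.IsHomogeneous 𝒮) :
    I.radical = sInf {J | J.IsHomogeneous 𝒮 ∧ I ≤ J ∧ J.IsPrime} := by
  simp_rw [((isHomogeneous_regrading_iff 𝒮 e).2 hI).radical_eq, isHomogeneous_regrading_iff]

end Regrading

/-- Homogeneous primes suffice to test membership of `S_{++}` in the radical of a homogeneous
ideal. -/
theorem plusPlus_le_radical {I : Ideal S} (hI : I.IsHomogeneous 𝒮)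
    (h : ∀ P ∈ proj 𝒮, ¬ I ≤ P.asIdeal) : plusPlus 𝒮 ≤ I.radical := by
  -- The lexicographic order is linear and compatible with addition, so the radical of a homogeneous
  -- ideal is an intersection of homogeneous primes; homogeneity itself does not depend on the
  -- order.
  let e : Lex (Fin d → ℕ) ≃+ (Fin d → ℕ) := { ofLex with map_add' := fun _ _ => rfl }
  rw [radical_eq_of_regrading e hI]
  refine le_sInf fun P ⟨hP, hIP, hprime⟩ => ?_
  by_contra hle
  exact h ⟨P, hprime⟩ ⟨hP, hle⟩ hIP

end Standard

/-! ### Prime avoidance over an infinite residue field. -/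

section Avoidance

variable {A S : Type*} [CommRing A] [IsLocalRing A] [Infinite (IsLocalRing.ResidueField A)]
  [CommRing S] [Algebra A S]

/-- Prime avoidance in an `A`-submodule, for `A` local with infinite residue field. -/
theorem exists_mem_forall_notMem_prime (V : Submodule A S) (s : Finset (Ideal S))
    (hs : ∀ P ∈ s, P.IsPrime ∧ ∃ y ∈ V, y ∉ P) : ∃ x ∈ V, ∀ P ∈ s, x ∉ P := by
  classical
  induction s using Finset.induction_on with
  | empty => exact ⟨0, zero_mem _, by simp⟩
  | insert P s _ ih =>
    obtain ⟨x, hxV, hx⟩ := ih fun Q hQ => hs Q (Finset.mem_insert_of_mem hQ)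
    by_cases hxP : x ∉ P
    · refine ⟨x, hxV, fun Q hQ => ?_⟩
      rcases Finset.mem_insert.1 hQ with rfl | hQ
      exacts [hxP, hx Q hQ]
    rw [not_not] at hxP
    obtain ⟨y, hyV, hyP⟩ := (hs P (Finset.mem_insert_self _ _)).2
    let r : IsLocalRing.ResidueField A → A :=
      Function.surjInv IsLocalRing.residue_surjective
    have hr : ∀ a, IsLocalRing.residue A (r a) = a :=
      Function.surjInv_eq IsLocalRing.residue_surjective
    -- Each prime excludes at most one residue class: for two distinct classes `r a - r b` is a
    -- unit, which forces `y` into Q and then `x` into Q. An infinite residue field leaves a class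
    -- that works for all primes.
    have hsub : ∀ Q ∈ insert P s,
        {a : IsLocalRing.ResidueField A | x + r a • y ∈ Q}.Subsingleton := by
      intro Q hQ a ha b hb
      by_contra hab
      have hunit : IsUnit (r a - r b) := by
        rw [← IsLocalRing.residue_ne_zero_iff_isUnit, map_sub, hr, hr]
        exact sub_ne_zero.2 hab
      have hyQ : y ∈ Q := by
        have h1 : (r a - r b) • y ∈ Q := by
          have := Q.sub_mem ha hb
          rwa [add_sub_add_left_eq_sub, ← sub_smul] at this
        obtain ⟨u, hu⟩ := hunit
        have h2 := Submodule.smul_of_tower_mem Q (↑u⁻¹ : A) h1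
        rwa [← hu, smul_smul, Units.inv_mul, one_smul] at h2
      rcases Finset.mem_insert.1 hQ with rfl | hQs
      · exact hyP hyQ
      · refine hx Q hQs ?_
        have := Q.sub_mem ha (Submodule.smul_of_tower_mem Q (r a) hyQ)
        rwa [add_sub_cancel_right] at this
    obtain ⟨a, ha⟩ := ((insert P s).finite_toSet.biUnion fun Q hQ =>
      (hsub Q hQ).finite).exists_notMem
    refine ⟨x + r a • y, V.add_mem hxV (V.smul_mem _ hyV), fun Q hQ hmem => ha ?_⟩
    exact Set.mem_biUnion hQ hmem

end Avoidance

/-! ### Vanishing in large degrees and filter-regular elements. -/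

section Graded

variable {d : ℕ} {A S M : Type*} [CommRing A] [CommRing S] [Algebra A S]
  {𝒮 : (Fin d → ℕ) → Submodule A S} [GradedAlgebra 𝒮]
  [AddCommGroup M] [Module A M] [Module S M] [IsScalarTower A S M]
  (ℳ : (Fin d → ℕ) → Submodule A M) [DirectSum.Decomposition ℳ] [SetLike.GradedSMul 𝒮 ℳ]

/-- An A-submodule of M_n is the degree n part of the S-submodule it spans, since S_0 comes from A;
ascending chains therefore transfer to M. -/
theorem isNoetherian_component (hS : IsStandard 𝒮) [IsNoetherian S M] (n : Fin d → ℕ) :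
    IsNoetherian A (ℳ n) := by
  let F : Submodule A (ℳ n) → Submodule S M := fun L =>
    Submodule.span S ((L.map (ℳ n).subtype : Submodule A M) : Set M)
  have hF : ∀ (L : Submodule A (ℳ n)) (z : ℳ n), (z : M) ∈ F L → z ∈ L := by
    intro L z hz
    have key : ∀ z ∈ F L, ∀ r : S, comp ℳ n (r • z) ∈ L.map (ℳ n).subtype := by
      intro z hz
      induction hz using Submodule.span_induction with
      | mem z hz =>
        intro r
        obtain ⟨y, hy, rfl⟩ := hz
        obtain ⟨a, ha⟩ := exists_algebraMap_eq_comp_zero hS r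
        have h := comp_smul_of_mem_right 𝒮 ℳ y.2 0 r
        rw [zero_add, ← ha, algebraMap_smul] at h
        rw [Submodule.subtype_apply, h]
        exact ⟨a • y, L.smul_mem a hy, rfl⟩
      | zero => simp
      | add x y _ _ hx hy =>
        intro r
        rw [smul_add, map_add]
        exact add_mem (hx r) (hy r)
      | smul s x _ hx =>
        intro r
        rw [smul_smul]
        exact hx _
    obtain ⟨y, hy, hyz⟩ := key z hz 1
    rw [one_smul, comp_of_mem z.2] at hyz
    exact Subtype.ext hyz ▸ hy
  have hmono : StrictMono F := by
    refine Monotone.strictMono_of_injective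
      (fun L L' h => Submodule.span_mono (Submodule.map_mono h)) ?_
    have hle : ∀ L L', F L = F L' → L ≤ L' := fun L L' h z hz =>
      hF L' z (h ▸ Submodule.subset_span ⟨z, hz, rfl⟩)
    exact fun L L' h => le_antisymm (hle _ _ h) (hle _ _ h.symm)
  rw [isNoetherian_iff']
  have := (isNoetherian_iff' (R := S) (M := M)).1 inferInstance
  exact hmono.wellFoundedGT

theorem length_ne_top [IsArtinianRing A] (hS : IsStandard 𝒮) [IsNoetherian S M]
    (n : Fin d → ℕ) : Module.length A (ℳ n) ≠ ⊤ := by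
  have := isNoetherian_component ℳ hS n
  exact Module.length_ne_top

theorem eventually_eq_bot_of_degProd_le (hS : IsStandard 𝒮) [Module.Finite S M]
    (m : Fin d → ℕ) (hm : degProd 𝒮 m ≤ Module.annihilator S M) :
    ∀ᶠ n in Filter.atTop, ℳ n = ⊥ := by
  obtain ⟨s, hs, hspan⟩ := exists_homogeneous_generators (S := S) ℳ
  choose! deg hdeg using hs
  -- This bound dominates `deg y + m` for every generator y, so only coefficients of degree at least
  -- `m` contribute, and these annihilate M.
  refine Filter.eventually_atTop.2 ⟨∑ y ∈ s, deg y + m, fun n hn => ?_⟩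
  rw [eq_bot_iff]
  intro z hz
  obtain ⟨f, -, hf⟩ := Submodule.mem_span_finset.1 (hspan ▸ Submodule.mem_top : z ∈ _)
  rw [Submodule.mem_bot, ← comp_of_mem hz, ← hf, map_sum]
  refine Finset.sum_eq_zero fun y hy => ?_
  have hy' : deg y + m ≤ n := le_trans (add_le_add_left
    (Finset.single_le_sum (f := deg) (fun _ _ => zero_le) hy) m) hn
  obtain ⟨k, rfl⟩ := exists_add_of_le hy'
  rw [show deg y + m + k = (m + k) + deg y by abel, comp_smul_of_mem_right 𝒮 ℳ (hdeg y hy)]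
  exact Module.mem_annihilator.1
    (hm (degProd_anti 𝒮 le_self_add (comp_mem_degProd hS (m + k) (f y)))) y

theorem eventually_eq_bot_of_plusPlus_le_radical [IsNoetherianRing S] (hS : IsStandard 𝒮)
    [Module.Finite S M] (h : plusPlus 𝒮 ≤ (Module.annihilator S M).radical) :
    ∀ᶠ n in Filter.atTop, ℳ n = ⊥ := by
  obtain ⟨c, hc⟩ := Ideal.exists_pow_le_of_le_radical_of_fg
    ((degProd_one_le_plusPlus 𝒮).trans h) (IsNoetherian.noetherian _)
  rw [degProd_one_pow] at hc
  exact eventually_eq_bot_of_degProd_le ℳ hS _ hc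

theorem eventually_eq_bot_of_forall_proj [IsNoetherianRing S] (hS : IsStandard 𝒮)
    [Module.Finite S M] (h : ∀ P ∈ proj 𝒮, ¬ Module.annihilator S M ≤ P.asIdeal) :
    ∀ᶠ n in Filter.atTop, ℳ n = ⊥ :=
  eventually_eq_bot_of_plusPlus_le_radical ℳ hS
    (plusPlus_le_radical (isHomogeneous_annihilator 𝒮 ℳ) h)

/-- Choose x outside the associated primes of M that do not contain S_{++}. The minimal primes over
the annihilator of the kernel of x are associated primes of M containing x, hence contain S_{++}, so
the kernel vanishes in large degrees. -/
theorem exists_isFilterRegular [IsLocalRing A] [Infinite (IsLocalRing.ResidueField A)]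
    [IsNoetherianRing S] (hS : IsStandard 𝒮) [Module.Finite S M] (i : Fin d) :
    ∃ x ∈ 𝒮 (Pi.single i 1), IsFilterRegular ℳ x := by
  classical
  let s : Finset (Ideal S) :=
    (associatedPrimes.finite S M).toFinset.filter fun P => ¬ plusPlus 𝒮 ≤ P
  obtain ⟨x, hxi, hx⟩ := exists_mem_forall_notMem_prime (𝒮 (Pi.single i 1)) s (by
    intro P hP
    rw [Finset.mem_filter, Set.Finite.mem_toFinset] at hP
    exact ⟨hP.1.isPrime, exists_mem_notMem_of_not_plusPlus_le (plusPlus_le_degProd_one hS) hP.2 i⟩)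
  refine ⟨x, hxi, ?_⟩
  let K : Submodule S M := LinearMap.ker (LinearMap.lsmul S M x)
  let := subDecomposition (isHomogeneous_ker_smul (ℳ := ℳ) hxi)
  have hK : plusPlus 𝒮 ≤ (Module.annihilator S K).radical := by
    rw [← Ideal.sInf_minimalPrimes]
    refine le_sInf fun P hP => ?_
    have hPM : P ∈ associatedPrimes S M := associatedPrimes.subset_of_injective
      (f := K.subtype) K.subtype_injective
      (Module.associatedPrimes.minimalPrimes_annihilator_subset_associatedPrimes S K hP)
    by_contra hle
    refine hx P (Finset.mem_filter.2 ⟨(Set.Finite.mem_toFinset _).2 hPM, hle⟩) (hP.1.2 ?_)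
    rw [Module.mem_annihilator]
    exact fun m => Subtype.ext m.2
  filter_upwards [eventually_eq_bot_of_plusPlus_le_radical (subGrading ℳ K) hS hK]
    with n hn m hm hxm
  have hmem : (⟨m, hxm⟩ : K) ∈ subGrading ℳ K n := hm
  rw [hn, Submodule.mem_bot] at hmem
  exact congrArg Subtype.val hmem

end Graded

/-! ### Length inequalities for linear maps. -/

section Length

variable {A V W U : Type*} [CommRing A] [AddCommGroup V] [AddCommGroup W] [AddCommGroup U]
  [Module A V] [Module A W] [Module A U]

theorem length_le_of_ker_le (f : V →ₗ[A] W) (g : V →ₗ[A] U) (hg : Function.Surjective g)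
    (h : LinearMap.ker f ≤ LinearMap.ker g) : Module.length A U ≤ Module.length A W := by
  have h1 : Module.length A U ≤ Module.length A (V ⧸ LinearMap.ker f) := by
    refine Module.length_le_of_surjective ((LinearMap.ker f).liftQ g h) fun u => ?_
    obtain ⟨v, rfl⟩ := hg u
    exact ⟨Submodule.Quotient.mk v, rfl⟩
  exact h1.trans (f.quotKerEquivRange.length_eq.le.trans
    (Module.length_le_of_injective _ (LinearMap.range f).subtype_injective))

theorem length_eq_ker_add_range (f : V →ₗ[A] W) :
    Module.length A V = Module.length A (LinearMap.ker f) + Module.length A (LinearMap.range f) :=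
  Module.length_eq_add_of_exact (LinearMap.ker f).subtype f.rangeRestrict
    (LinearMap.ker f).subtype_injective f.surjective_rangeRestrict (by
      rw [LinearMap.exact_iff, LinearMap.ker_rangeRestrict, Submodule.range_subtype])

end Length

/-! ### Hilbert functions and uniqueness of the coefficients. -/

section Hilbert

variable {d : ℕ} {A M : Type*} [CommRing A] [AddCommGroup M] [Module A M]

/-- The Hilbert function `n ↦ ℓ_A(M_n)`. -/
noncomputable def hilb (ℳ : (Fin d → ℕ) → Submodule A M) (n : Fin d → ℕ) : ℤ :=
  ((Module.length A (ℳ n)).toNat : ℤ)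

/-- `ℓ_A(M_n) = ∑ k, e k * binom(n + k, k)` for all large `n`. -/
def HasExpansion (ℳ : (Fin d → ℕ) → Submodule A M) (e : (Fin d → ℕ) →₀ ℤ) : Prop :=
  ∀ᶠ n in Filter.atTop, hilb ℳ n = binomSum e n

theorem hilb_eq_zero {ℳ : (Fin d → ℕ) → Submodule A M} {n : Fin d → ℕ} (h : ℳ n = ⊥) :
    hilb ℳ n = 0 := by
  rw [hilb, h, Module.length_bot]
  rfl

theorem hasExpansion_zero {ℳ : (Fin d → ℕ) → Submodule A M}
    (h : ∀ᶠ n in Filter.atTop, ℳ n = ⊥) : HasExpansion ℳ 0 := by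
  filter_upwards [h] with n hn
  rw [hilb_eq_zero hn, binomSum_zero]

theorem hilbertCoeff_eq {ℳ : (Fin d → ℕ) → Submodule A M}
    (hfin : ∀ n, Module.length A (ℳ n) ≠ ⊤) {e : (Fin d → ℕ) →₀ ℤ} (he : HasExpansion ℳ e) :
    hilbertCoeff ℳ = e := by
  set Q : MvPolynomial (Fin d) ℚ := e.sum fun k c => (c : ℚ) • binomPoly k with hQ
  have hex : IsHilbertPolynomial ℳ Q := by
    filter_upwards [he] with n hn
    refine ⟨_, (ENat.natCast_toNat (hfin n)).symm, ?_⟩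
    rw [hQ, eval_binomial_expansion, ← hn, hilb, Int.cast_natCast]
  have hP : hilbertPolynomial ℳ = Q := by
    have hex' : ∃ P, IsHilbertPolynomial ℳ P := ⟨Q, hex⟩
    rw [hilbertPolynomial, dif_pos hex']
    refine eq_of_eventually_eval_eq ?_
    filter_upwards [hex, hex'.choose_spec] with n ⟨l, hl, hl'⟩ ⟨m, hm, hm'⟩
    rw [hl', hm']
    rw [hl] at hm
    exact_mod_cast hm.symm
  have hB : ∃ e, IsBinomialExpansion (hilbertPolynomial ℳ) e := ⟨e, hP⟩
  rw [hilbertCoeff, dif_pos hB]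
  refine eq_of_eventually_binomSum_eq (Filter.Eventually.of_forall fun n => ?_)
  have h : Q = _ := hP.symm.trans hB.choose_spec
  have h' := congrArg (MvPolynomial.eval fun i => (n i : ℚ)) h
  rw [eval_binomial_expansion, eval_binomial_expansion] at h'
  exact_mod_cast h'.symm

end Hilbert

/-! ### The difference formula and existence of Hilbert polynomials. -/

section Graded

variable {d : ℕ} {A S M M' : Type*} [CommRing A] [CommRing S] [Algebra A S]
  {𝒮 : (Fin d → ℕ) → Submodule A S} [GradedAlgebra 𝒮]
  [AddCommGroup M] [Module A M] [Module S M] [IsScalarTower A S M]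
  (ℳ : (Fin d → ℕ) → Submodule A M) [DirectSum.Decomposition ℳ] [SetLike.GradedSMul 𝒮 ℳ]
  [AddCommGroup M'] [Module A M'] [Module S M'] [IsScalarTower A S M']
  (ℳ' : (Fin d → ℕ) → Submodule A M')

variable {ℳ ℳ'} in
-- Additivity of length along 0 → (0 : x)_n → M_n → M_{a+n} → (M/xM)_{a+n} → 0, without subtraction
-- in `ℕ∞`. Keeping `φ` abstract covers both M → M/xM and M/N → M/N'.
theorem length_add_length_quotient {a : Fin d → ℕ} {x : S} (hx : x ∈ 𝒮 a) (φ : M →ₗ[S] M')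
    (hφ : ∀ m, φ m = 0 ↔ ∃ y, m = x • y)
    (hmap : ∀ n, (ℳ n).map (φ.restrictScalars A) = ℳ' n) (n : Fin d → ℕ) :
    Module.length A (ℳ n) + Module.length A (ℳ' (a + n)) =
      Module.length A (subGrading ℳ (LinearMap.ker (LinearMap.lsmul S M x)) n) +
        Module.length A (ℳ (a + n)) := by
  let g : ℳ n →ₗ[A] ℳ (a + n) := ((LinearMap.lsmul S M x).restrictScalars A).restrict
    fun m hm => smul_mem_add hx hm
  let h : ℳ (a + n) →ₗ[A] ℳ' (a + n) := (φ.restrictScalars A).restrict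
    fun m hm => hmap (a + n) ▸ Submodule.mem_map_of_mem hm
  have h1 := length_eq_ker_add_range g
  have h2 : Module.length A (ℳ (a + n)) =
      Module.length A (LinearMap.range g) + Module.length A (ℳ' (a + n)) := by
    refine Module.length_eq_add_of_exact (LinearMap.range g).subtype h
      (LinearMap.range g).subtype_injective ?_ ?_
    · rintro ⟨m', hm'⟩
      rw [← hmap] at hm'
      obtain ⟨m, hm, rfl⟩ := hm'
      exact ⟨⟨m, hm⟩, rfl⟩
    · intro m
      rw [Submodule.coe_subtype, Subtype.range_coe]
      constructor
      · intro hm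
        obtain ⟨y, hy⟩ := (hφ m).1 (congrArg Subtype.val hm)
        refine ⟨⟨comp ℳ n y, comp_mem ℳ n y⟩, Subtype.ext ?_⟩
        change x • comp ℳ n y = m
        rw [← comp_smul_of_mem_left ℳ hx, ← hy, comp_of_mem m.2]
      · rintro ⟨y, rfl⟩
        exact Subtype.ext ((hφ _).2 ⟨y, rfl⟩)
  have h3 : Module.length A (LinearMap.ker g) =
      Module.length A (subGrading ℳ (LinearMap.ker (LinearMap.lsmul S M x)) n) := by
    refine LinearEquiv.length_eq
      { toFun := fun m => ⟨⟨m.1.1, congrArg Subtype.val m.2⟩, m.1.2⟩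
        invFun := fun m => ⟨⟨m.1.1, m.2⟩, Subtype.ext m.1.2⟩
        map_add' := fun _ _ => rfl
        map_smul' := fun _ _ => rfl
        left_inv := fun _ => rfl
        right_inv := fun _ => rfl }
  rw [h1, h2, h3, add_assoc]

variable {ℳ ℳ'} in
theorem hilb_add_hilb_quotient [IsArtinianRing A] (hS : IsStandard 𝒮) [IsNoetherianRing S]
    [Module.Finite S M] {a : Fin d → ℕ} {x : S} (hx : x ∈ 𝒮 a) (φ : M →ₗ[S] M')
    (hφ : ∀ m, φ m = 0 ↔ ∃ y, m = x • y)
    (hmap : ∀ n, (ℳ n).map (φ.restrictScalars A) = ℳ' n) (n : Fin d → ℕ) :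
    hilb ℳ n + hilb ℳ' (n + a) =
      hilb (subGrading ℳ (LinearMap.ker (LinearMap.lsmul S M x))) n + hilb ℳ (n + a) := by
  have h := length_add_length_quotient hx φ hφ hmap n
  let := subDecomposition (isHomogeneous_ker_smul (ℳ := ℳ) hx)
  have h1 := length_ne_top ℳ hS n
  have h2 := length_ne_top ℳ hS (a + n)
  have h3 := length_ne_top (subGrading ℳ (LinearMap.ker (LinearMap.lsmul S M x))) hS n
  have h4 : Module.length A (ℳ' (a + n)) ≠ ⊤ := by
    intro h4
    rw [h4, add_top] at h
    exact WithTop.add_ne_top.2 ⟨h3, h2⟩ h.symm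
  have h' := congrArg ENat.toNat h
  rw [ENat.toNat_add h1 h4, ENat.toNat_add h3 h2] at h'
  unfold hilb
  rw [add_comm n a]
  exact_mod_cast h'

variable {ℳ} in
theorem eventually_subGrading_ker_eq_bot {x : S} (h : IsFilterRegular ℳ x) :
    ∀ᶠ n in Filter.atTop, subGrading ℳ (LinearMap.ker (LinearMap.lsmul S M x)) n = ⊥ := by
  filter_upwards [h] with n hn
  rw [eq_bot_iff]
  exact fun m hm => Subtype.ext (hn m hm m.2)

theorem factor_eq_zero_iff {N N' : Submodule S M} {x : S}
    (hN : N' = N ⊔ Ideal.span {x} • ⊤) (m : M ⧸ N) :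
    Submodule.factor (hN ▸ le_sup_left : N ≤ N') m = 0 ↔ ∃ y, m = x • y := by
  obtain ⟨m, rfl⟩ := N.mkQ_surjective m
  change Submodule.Quotient.mk m = 0 ↔ _
  rw [Submodule.Quotient.mk_eq_zero, hN, Submodule.ideal_span_singleton_smul]
  constructor
  · intro hm
    obtain ⟨b, hb, z, hz, rfl⟩ := Submodule.mem_sup.1 hm
    obtain ⟨y, -, rfl⟩ := Submodule.mem_smul_pointwise_iff_exists _ _ _ |>.1 hz
    refine ⟨N.mkQ y, ?_⟩
    rw [map_add, map_smul, Submodule.mkQ_apply, (Submodule.Quotient.mk_eq_zero N).2 hb, zero_add]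
  · rintro ⟨y, hy⟩
    obtain ⟨y, rfl⟩ := N.mkQ_surjective y
    rw [← map_smul, ← sub_eq_zero, ← map_sub, Submodule.mkQ_apply,
      Submodule.Quotient.mk_eq_zero] at hy
    have := Submodule.add_mem_sup hy
      (Submodule.smul_mem_pointwise_smul y x ⊤ (Submodule.mem_top : y ∈ (⊤ : Submodule S M)))
    rwa [sub_add_cancel] at this

theorem map_factor_quotientGrading {N N' : Submodule S M} (h : N ≤ N') (n : Fin d → ℕ) :
    (quotientGrading ℳ N n).map ((Submodule.factor h).restrictScalars A) =
      quotientGrading ℳ N' n := by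
  unfold quotientGrading
  rw [← Submodule.map_comp]
  rfl

theorem mkQ_eq_zero_iff (x : S) (m : M) :
    (Ideal.span {x} • ⊤ : Submodule S M).mkQ m = 0 ↔ ∃ y, m = x • y := by
  rw [Submodule.mkQ_apply, Submodule.Quotient.mk_eq_zero, Submodule.ideal_span_singleton_smul,
    Submodule.mem_smul_pointwise_iff_exists]
  simp [eq_comm]

theorem isHomogeneous_span_of_mem {s : Set S} (hs : ∀ x ∈ s, ∃ n, x ∈ 𝒮 n) :
    (Ideal.span s).IsHomogeneous 𝒮 := Ideal.homogeneous_span 𝒮 s hs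

/-- The difference formula for the quotient by a filter-regular element. -/
theorem eventually_hilb_quotient [IsArtinianRing A] (hS : IsStandard 𝒮) [IsNoetherianRing S]
    [Module.Finite S M] {N N' : Submodule S M} (hNh : N.IsHomogeneous ℳ) {i : Fin d} {x : S}
    (hx : x ∈ 𝒮 (Pi.single i 1)) (hreg : IsFilterRegular (quotientGrading ℳ N) x)
    (hN : N' = N ⊔ Ideal.span {x} • ⊤) :
    ∀ᶠ n in Filter.atTop, hilb (quotientGrading ℳ N) (n + Pi.single i 1) =
      hilb (quotientGrading ℳ N) n + hilb (quotientGrading ℳ N') (n + Pi.single i 1) := by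
  let := quotientDecomposition hNh
  filter_upwards [eventually_subGrading_ker_eq_bot hreg] with n hn
  have := hilb_add_hilb_quotient hS hx (Submodule.factor (hN ▸ le_sup_left : N ≤ N'))
    (factor_eq_zero_iff hN) (map_factor_quotientGrading ℳ _) n
  rw [this, hilb_eq_zero hn, zero_add]

theorem hilb_quotientGrading_bot (n : Fin d → ℕ) :
    hilb (quotientGrading ℳ (⊥ : Submodule S M)) n = hilb ℳ n := by
  unfold hilb quotientGrading
  rw [LinearEquiv.length_eq (Submodule.equivMapOfInjective
    ((⊥ : Submodule S M).mkQ.restrictScalars A) ?_ (ℳ n))]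
  rw [← LinearMap.ker_eq_bot, LinearMap.ker_restrictScalars, Submodule.ker_mkQ]
  rfl

variable [IsArtinianRing A] [IsLocalRing A] [Infinite (IsLocalRing.ResidueField A)]

/-- Noetherian induction from larger submodules. With a filter-regular x_i in each direction, the
differences of the Hilbert function of M/N are those of its quotients by x_i, to be summed up. If
some x_i kills M/N, filter-regularity makes M/N vanish in large degrees. -/
theorem exists_hasExpansion_quotient (hS : IsStandard 𝒮) [IsNoetherianRing S] [Module.Finite S M]
    (N : Submodule S M) (hN : N.IsHomogeneous ℳ) :
    ∃ e, HasExpansion (quotientGrading ℳ N) e := by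
  induction N using IsNoetherian.induction with
  | _ N ih =>
  let := quotientDecomposition hN
  choose x hx hreg using exists_isFilterRegular (quotientGrading ℳ N) hS
  let N' : Fin d → Submodule S M := fun i => N ⊔ Ideal.span {x i} • ⊤
  have hN' : ∀ i, (N' i).IsHomogeneous ℳ := fun i => isHomogeneous_sup hN
    (isHomogeneous_smul_top 𝒮 ℳ (isHomogeneous_span_of_mem (by
      rintro _ rfl
      exact ⟨_, hx i⟩)))
  by_cases hlt : ∀ i, N < N' i
  · choose g hg using fun i => ih (N' i) (hlt i) (hN' i)
    refine exists_binomSum_of_differences _ g fun i => ?_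
    filter_upwards [eventually_hilb_quotient ℳ hS hN (hx i) (hreg i) rfl,
      eventually_add (Pi.single i 1) (hg i)] with n h1 h2
    rw [h1, h2]
  · push Not at hlt
    obtain ⟨i, hi⟩ := hlt
    have hle : N' i ≤ N := by
      by_contra hle
      exact hi (lt_of_le_not_ge le_sup_left hle)
    refine ⟨0, hasExpansion_zero ?_⟩
    filter_upwards [hreg i] with n hn
    rw [eq_bot_iff]
    intro m hm
    refine hn m hm ?_
    obtain ⟨m, rfl⟩ := N.mkQ_surjective m
    rw [← map_smul, Submodule.mkQ_apply, Submodule.Quotient.mk_eq_zero]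
    exact hle (Submodule.mem_sup_right
      (Submodule.smul_mem_smul (Ideal.mem_span_singleton_self _) trivial))

theorem exists_hasExpansion (hS : IsStandard 𝒮) [IsNoetherianRing S] [Module.Finite S M] :
    ∃ e, HasExpansion ℳ e := by
  obtain ⟨e, he⟩ := exists_hasExpansion_quotient ℳ hS ⊥ (by
    rintro n m rfl
    simp)
  refine ⟨e, ?_⟩
  filter_upwards [he] with n hn
  rwa [hilb_quotientGrading_bot] at hn

end Graded

/-! ### Filter-regular sequences. -/

section Sequences

variable {d : ℕ} {A S M : Type*} [CommRing A] [CommRing S] [Algebra A S]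
  {𝒮 : (Fin d → ℕ) → Submodule A S} [GradedAlgebra 𝒮]
  [AddCommGroup M] [Module A M] [Module S M] [IsScalarTower A S M]
  (ℳ : (Fin d → ℕ) → Submodule A M) [DirectSum.Decomposition ℳ] [SetLike.GradedSMul 𝒮 ℳ]

theorem isHomogeneous_span_image_smul_top {t : ℕ} {c : Fin t → Fin d} {x : Fin t → S}
    (hx : ∀ j, x j ∈ 𝒮 (Pi.single (c j) 1)) (s : Set (Fin t)) :
    (Ideal.span (x '' s) • (⊤ : Submodule S M)).IsHomogeneous ℳ :=
  isHomogeneous_smul_top 𝒮 ℳ (isHomogeneous_span_of_mem (by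
    rintro _ ⟨j, -, rfl⟩
    exact ⟨_, hx j⟩))

theorem hasExpansion_quotient_of_isFilterRegularSequence [IsArtinianRing A] (hS : IsStandard 𝒮)
    [IsNoetherianRing S] [Module.Finite S M] {e : (Fin d → ℕ) →₀ ℤ} (he : HasExpansion ℳ e)
    {t : ℕ} {c : Fin t → Fin d} {x : Fin t → S} (hx : ∀ j, x j ∈ 𝒮 (Pi.single (c j) 1))
    (hreg : IsFilterRegularSequence ℳ x) :
    HasExpansion (quotientGrading ℳ (Ideal.span (Set.range x) • (⊤ : Submodule S M)))
      (shift (∑ j, Pi.single (c j) 1) e) := by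
  -- Induction over initial segments of 𝐱; each new element shifts the coefficients by one more unit
  -- vector.
  have key : ∀ l ≤ t, HasExpansion
      (quotientGrading ℳ (Ideal.span (x '' {j : Fin t | (j : ℕ) < l}) • (⊤ : Submodule S M)))
      (shift (∑ j ∈ Finset.univ.filter (fun j : Fin t => (j : ℕ) < l), Pi.single (c j) 1) e) := by
    intro l
    induction l with
    | zero =>
      intro _
      have h0 : Ideal.span (x '' {j : Fin t | (j : ℕ) < 0}) • (⊤ : Submodule S M) = ⊥ := by simp
      rw [h0]
      filter_upwards [he] with n hn
      rw [hilb_quotientGrading_bot, hn]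
      simp
    | succ l ih =>
      intro hl
      let j : Fin t := ⟨l, hl⟩
      have hset : {j' : Fin t | (j' : ℕ) < l + 1} = insert j {j' : Fin t | (j' : ℕ) < l} := by
        ext j'
        simp [j, Fin.ext_iff, Nat.le_iff_lt_or_eq, or_comm]
      have hsum : ∑ j' ∈ Finset.univ.filter (fun j : Fin t => (j : ℕ) < l + 1), (Pi.single (c j') 1 : Fin d → ℕ) =
          Pi.single (c j) 1 + ∑ j' ∈ Finset.univ.filter (fun j : Fin t => (j : ℕ) < l), Pi.single (c j') 1 := by
        have hins : Finset.univ.filter (fun j : Fin t => (j : ℕ) < l + 1) =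
            insert j (Finset.univ.filter fun j : Fin t => (j : ℕ) < l) := by
          ext j'
          simp [j, Fin.ext_iff, Nat.le_iff_lt_or_eq, or_comm]
        rw [hins, Finset.sum_insert (by simp [j])]
      rw [hsum, ← shift_shift]
      have ih := ih (Nat.le_of_succ_le hl)
      generalize shift (∑ j' ∈ Finset.univ.filter (fun j : Fin t => (j : ℕ) < l), Pi.single (c j') 1) e = f at ih ⊢
      refine eventually_of_eventually_add (Pi.single (c j) 1) ?_
      have hN : Ideal.span (x '' {j' : Fin t | (j' : ℕ) < l + 1}) • (⊤ : Submodule S M) =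
          Ideal.span (x '' {j' : Fin t | (j' : ℕ) < l}) • ⊤ ⊔ Ideal.span {x j} • ⊤ := by
        rw [hset, Set.image_insert_eq, Ideal.span_insert, Submodule.sup_smul, sup_comm]
      filter_upwards [ih, eventually_add (Pi.single (c j) 1) ih, eventually_hilb_quotient ℳ hS
        (isHomogeneous_span_image_smul_top ℳ hx _) (hx j) (hreg j) hN] with n h1 h2 h3
      have h4 := binomSum_add_single f n (c j)
      change hilb (quotientGrading ℳ (Ideal.span (x '' {j' : Fin t | (j' : ℕ) < l}) • ⊤)) _ =
        hilb (quotientGrading ℳ (Ideal.span (x '' {j' : Fin t | (j' : ℕ) < l}) • ⊤)) _ + _ at h3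
      linarith
  have huniv : {j : Fin t | (j : ℕ) < t} = Set.univ := Set.eq_univ_of_forall fun j => j.2
  have h := key t le_rfl
  rw [huniv, Set.image_univ] at h
  simpa using h

theorem exists_isFilterRegularSequence [IsLocalRing A] [Infinite (IsLocalRing.ResidueField A)]
    (hS : IsStandard 𝒮) [IsNoetherianRing S] [Module.Finite S M] (t : ℕ) (c : Fin t → Fin d) :
    ∃ x : Fin t → S, (∀ j, x j ∈ 𝒮 (Pi.single (c j) 1)) ∧ IsFilterRegularSequence ℳ x := by
  induction t with
  | zero => exact ⟨Fin.elim0, fun j => j.elim0, fun j => j.elim0⟩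
  | succ t ih =>
    obtain ⟨x, hx, hreg⟩ := ih fun j => c j.castSucc
    have hhom := isHomogeneous_span_image_smul_top ℳ hx Set.univ
    let := quotientDecomposition hhom
    obtain ⟨y, hy, hyreg⟩ := exists_isFilterRegular
      (quotientGrading ℳ (Ideal.span (x '' Set.univ) • (⊤ : Submodule S M))) hS (c (Fin.last t))
    refine ⟨Fin.snoc x y, fun j => ?_, fun j => ?_⟩
    · induction j using Fin.lastCases with
      | last => simpa using hy
      | cast j => simpa using hx j
    · induction j using Fin.lastCases with
      | last =>
        have h : (Fin.snoc x y : Fin (t + 1) → S) '' Set.Iio (Fin.last t) = x '' Set.univ := by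
          ext z
          constructor
          · rintro ⟨j, hj, rfl⟩
            obtain ⟨j, rfl⟩ := Fin.exists_castSucc_eq.2 (Set.mem_Iio.1 hj).ne
            exact ⟨j, trivial, by simp⟩
          · rintro ⟨j, -, rfl⟩
            exact ⟨j.castSucc, Fin.castSucc_lt_last j, by simp⟩
        rw [h, Fin.snoc_last]
        exact hyreg
      | cast j =>
        have h : (Fin.snoc x y : Fin (t + 1) → S) '' Set.Iio j.castSucc = x '' Set.Iio j := by
          ext z
          constructor
          · rintro ⟨j', hj', rfl⟩
            obtain ⟨j', rfl⟩ := Fin.exists_castSucc_eq.2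
              ((Set.mem_Iio.1 hj').trans (Fin.castSucc_lt_last j)).ne
            exact ⟨j', Fin.castSucc_lt_castSucc_iff.1 hj', by simp⟩
          · rintro ⟨j', hj', rfl⟩
            exact ⟨j'.castSucc, Fin.castSucc_lt_castSucc_iff.2 hj', by simp⟩
        rw [h, Fin.snoc_castSucc]
        exact hreg j

theorem sum_single_eq_of_card_eq {t : ℕ} {c : Fin t → Fin d} {k : Fin d → ℕ}
    (hc : ∀ i, (Finset.univ.filter fun j => c j = i).card = k i) :
    ∑ j, (Pi.single (c j) 1 : Fin d → ℕ) = k := by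
  ext i
  rw [Finset.sum_apply, ← hc i, Finset.card_filter]
  exact Finset.sum_congr rfl fun j _ => by simp [Pi.single_apply, eq_comm]

theorem exists_card_fiber_eq (k : Fin d → ℕ) : ∃ (t : ℕ) (c : Fin t → Fin d),
    ∀ i, (Finset.univ.filter fun j => c j = i).card = k i := by
  let E := Fintype.equivFin (Σ i, Fin (k i))
  refine ⟨_, fun j => (E.symm j).1, fun i => ?_⟩
  refine Eq.trans ?_ (Finset.card_fin (k i))
  symm
  refine Finset.card_bij (fun a _ => E ⟨i, a⟩) ?_ ?_ ?_
  · simp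
  · intro a _ b _ h
    simpa using h
  · intro j hj
    obtain ⟨⟨i', a⟩, rfl⟩ := E.surjective j
    obtain rfl : i' = i := by simpa using hj
    exact ⟨a, Finset.mem_univ _, rfl⟩

end Sequences

/-! ### Arbitrary sequences with empty relevant support. -/

section Vanishing

universe u

variable {d : ℕ} {A S : Type*} [CommRing A] [CommRing S] [Algebra A S]
  {𝒮 : (Fin d → ℕ) → Submodule A S} [GradedAlgebra 𝒮]
  [IsArtinianRing A] [IsLocalRing A] [Infinite (IsLocalRing.ResidueField A)]

/-- If no relevant prime in the support of `M` contains the sequence `x`, then the corresponding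
iterated difference of the Hilbert polynomial of `M` vanishes. -/
theorem shift_eq_zero_of_forall_proj (hS : IsStandard 𝒮) [IsNoetherianRing S] (t : ℕ)
    (c : Fin t → Fin d) (x : Fin t → S) (hx : ∀ j, x j ∈ 𝒮 (Pi.single (c j) 1))
    (M : Type u) [AddCommGroup M] [Module A M] [Module S M] [IsScalarTower A S M]
    [Module.Finite S M] (ℳ : (Fin d → ℕ) → Submodule A M) [DirectSum.Decomposition ℳ]
    [SetLike.GradedSMul 𝒮 ℳ]
    (hP : ∀ P ∈ proj 𝒮, Module.annihilator S M ≤ P.asIdeal → ¬ ∀ j, x j ∈ P.asIdeal)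
    (e : (Fin d → ℕ) →₀ ℤ) (he : HasExpansion ℳ e) :
    shift (∑ j, Pi.single (c j) 1) e = 0 := by
  induction t generalizing M e with
  | zero =>
    have h0 := eventually_eq_bot_of_forall_proj ℳ hS fun P hPp hle =>
      hP P hPp hle fun j => j.elim0
    rw [Fin.sum_univ_zero, shift_zero_left]
    refine eq_of_eventually_binomSum_eq ?_
    filter_upwards [he, hasExpansion_zero h0] with n h1 h2
    rw [← h1, h2]
  | succ t ih =>
    set i := c 0
    let N : Submodule S M := Ideal.span {x 0} • ⊤
    let K : Submodule S M := LinearMap.ker (LinearMap.lsmul S M (x 0))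
    have hN : N.IsHomogeneous ℳ := isHomogeneous_smul_top 𝒮 ℳ (isHomogeneous_span_of_mem (by
      rintro _ rfl
      exact ⟨_, hx 0⟩))
    let := quotientDecomposition hN
    let := subDecomposition (isHomogeneous_ker_smul (ℳ := ℳ) (hx 0))
    obtain ⟨f, hf⟩ := exists_hasExpansion (quotientGrading ℳ N) hS
    obtain ⟨g, hg⟩ := exists_hasExpansion (subGrading ℳ K) hS
    -- Both M/x₀M and the kernel of x₀ are killed by x₀, so a relevant prime containing either
    -- annihilator already contains x₀, and the hypothesis passes to the shorter sequence.
    have hf0 := ih (fun j => c j.succ) (fun j => x j.succ) (fun j => hx j.succ) (M ⧸ N)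
      (quotientGrading ℳ N) (fun P hPp hle hall => by
        refine hP P hPp (le_trans ?_ hle) (Fin.cases (hle ?_) hall)
        · exact LinearMap.annihilator_le_of_surjective N.mkQ N.mkQ_surjective
        · rw [Module.mem_annihilator]
          intro m
          obtain ⟨m, rfl⟩ := N.mkQ_surjective m
          rw [← map_smul]
          exact (mkQ_eq_zero_iff _ _).2 ⟨m, rfl⟩) f hf
    have hg0 := ih (fun j => c j.succ) (fun j => x j.succ) (fun j => hx j.succ) K
      (subGrading ℳ K) (fun P hPp hle hall => by
        refine hP P hPp (le_trans ?_ hle) (Fin.cases (hle ?_) hall)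
        · exact LinearMap.annihilator_le_of_injective K.subtype K.subtype_injective
        · rw [Module.mem_annihilator]
          exact fun m => Subtype.ext m.2) g hg
    -- The kernel enters in degree n and the other terms in degree n + e_i; rewriting its value at n
    -- through its own difference produces the extra `shift` term.
    have hdiff : shift (Pi.single i 1) e = f - g + shift (Pi.single i 1) g := by
      refine eq_of_eventually_binomSum_eq (eventually_of_eventually_add (Pi.single i 1) ?_)
      filter_upwards [he, eventually_add (Pi.single i 1) he, eventually_add (Pi.single i 1) hf,
        hg] with n h1 h2 h3 h4
      have h5 := hilb_add_hilb_quotient (ℳ := ℳ) (ℳ' := quotientGrading ℳ N) hS (hx 0) N.mkQ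
        (mkQ_eq_zero_iff _) (fun _ => rfl) n
      rw [binomSum_add, binomSum_sub]
      have h6 := binomSum_add_single e n i
      have h7 := binomSum_add_single g n i
      rw [h1, h2, h3, h4] at h5
      linarith
    rw [Fin.sum_univ_succ, add_comm, ← shift_shift, hdiff, shift_add, shift_sub, hf0, hg0,
      shift_shift, add_comm (∑ j : Fin t, _), ← shift_shift, hg0]
    simp

end Vanishing

/-! ### The dimension of Supp_{++} from the Hilbert function. -/

section Dimension

variable {d : ℕ} {A S M : Type*} [CommRing A] [CommRing S] [Algebra A S]
  {𝒮 : (Fin d → ℕ) → Submodule A S} [GradedAlgebra 𝒮]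
  [AddCommGroup M] [Module A M] [Module S M] [IsScalarTower A S M]
  (ℳ : (Fin d → ℕ) → Submodule A M) [DirectSum.Decomposition ℳ] [SetLike.GradedSMul 𝒮 ℳ]

theorem mem_suppPlusPlus_iff [Module.Finite S M] {P : PrimeSpectrum S} :
    P ∈ suppPlusPlus 𝒮 M ↔ P ∈ proj 𝒮 ∧ Module.annihilator S M ≤ P.asIdeal := by
  rw [suppPlusPlus, Module.support_eq_zeroLocus]
  rfl

/-- Over a prime in the support of `M`, the Hilbert function of `S ⧸ P` is bounded by translates
of the Hilbert function of `M`. -/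
theorem exists_length_quotient_le [Module.Finite S M] : ∃ (s : Finset M) (deg : M → Fin d → ℕ),
    ∀ P : Ideal S, Module.annihilator S M ≤ P → ∀ n,
      Module.length A (quotientGrading 𝒮 P n) ≤
        ∑ y ∈ s, Module.length A (ℳ (n + deg y)) := by
  obtain ⟨s, hs, hspan⟩ := exists_homogeneous_generators (S := S) ℳ
  choose! deg hdeg using hs
  refine ⟨s, deg, fun P hP n => ?_⟩
  -- The map r ↦ (r y)_y over the generators y: its kernel annihilates M and so lies in P.
  let f : 𝒮 n →ₗ[A] (y : s) → ℳ (n + deg y) := LinearMap.pi fun y =>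
    (((LinearMap.toSpanSingleton S M y).restrictScalars A).restrict
      fun r hr => smul_mem_add hr (hdeg y y.2))
  let g : 𝒮 n →ₗ[A] quotientGrading 𝒮 P n :=
    ((Submodule.mkQ P).restrictScalars A).restrict fun r hr => ⟨r, hr, rfl⟩
  have h := length_le_of_ker_le f g (by
    rintro ⟨_, r, hr, rfl⟩
    exact ⟨⟨r, hr⟩, rfl⟩) (by
    intro r hr
    refine Subtype.ext ((Submodule.Quotient.mk_eq_zero P).2 (hP ?_))
    have h1 : (⊤ : Submodule S M) ≤ LinearMap.ker (LinearMap.lsmul S M r) := by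
      rw [← hspan, Submodule.span_le]
      intro y hy
      exact congrArg Subtype.val (congrFun hr ⟨y, hy⟩)
    exact Module.mem_annihilator.2 fun m => h1 trivial)
  rwa [Module.length_pi_of_fintype, Finset.sum_coe_sort s
    fun y => Module.length A (ℳ (n + deg y))] at h

theorem one_le_length_quotient (hS : IsStandard 𝒮) {P : PrimeSpectrum S} (hP : P ∈ proj 𝒮)
    (n : Fin d → ℕ) : 1 ≤ Module.length A (quotientGrading 𝒮 P.asIdeal n) := by
  choose x hx hxP using
    exists_mem_notMem_of_not_plusPlus_le (plusPlus_le_degProd_one hS) hP.2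
  have h : ∏ i, x i ^ n i ∉ P.asIdeal := by
    intro h
    obtain ⟨i, -, hi⟩ := (P.isPrime.prod_mem_iff).1 h
    exact hxP i (P.isPrime.mem_of_pow_mem _ hi)
  rw [Order.one_le_iff_pos, Module.length_pos_iff]
  refine ⟨⟨_, ∏ i, x i ^ n i, prod_pow_mem 𝒮 hx n, rfl⟩, 0, fun h0 => h ?_⟩
  exact (Submodule.Quotient.mk_eq_zero _).1 (congrArg Subtype.val h0)

/-- Multiplication by `r` embeds (S/P)_n into the kernel of (S/P)_{a+n} → (S/Q)_{a+n}. -/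
theorem length_quotient_add_le {P Q : Ideal S} [P.IsPrime] (hPQ : P ≤ Q) {a : Fin d → ℕ} {r : S}
    (hr : r ∈ 𝒮 a) (hrQ : r ∈ Q) (hrP : r ∉ P) (n : Fin d → ℕ) :
    Module.length A (quotientGrading 𝒮 P n) + Module.length A (quotientGrading 𝒮 Q (a + n)) ≤
      Module.length A (quotientGrading 𝒮 P (a + n)) := by
  let h : quotientGrading 𝒮 P (a + n) →ₗ[A] quotientGrading 𝒮 Q (a + n) :=
    ((Submodule.factor hPQ).restrictScalars A).restrict (by
      rintro _ ⟨s, hs, rfl⟩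
      exact ⟨s, hs, rfl⟩)
  have hsurj : Function.Surjective h := by
    rintro ⟨_, s, hs, rfl⟩
    exact ⟨⟨_, s, hs, rfl⟩, rfl⟩
  let g : quotientGrading 𝒮 P n →ₗ[A] quotientGrading 𝒮 P (a + n) :=
    ((LinearMap.lsmul S (S ⧸ P) r).restrictScalars A).restrict
      fun m hm => SetLike.GradedSMul.smul_mem hr hm
  have hginj : Function.Injective g := by
    rw [← LinearMap.ker_eq_bot, eq_bot_iff]
    rintro ⟨_, s, hs, rfl⟩ hm
    have h1 : r * s ∈ P := (Submodule.Quotient.mk_eq_zero P).1 (congrArg Subtype.val hm)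
    exact Subtype.ext ((Submodule.Quotient.mk_eq_zero P).2
      ((Ideal.IsPrime.mem_or_mem ‹_› h1).resolve_left hrP))
  have hgh : ∀ m, g m ∈ LinearMap.ker h := by
    rintro ⟨_, s, hs, rfl⟩
    exact Subtype.ext ((Submodule.Quotient.mk_eq_zero Q).2 (Q.mul_mem_right s hrQ))
  rw [length_eq_ker_add_range h, LinearMap.range_eq_top.2 hsurj, Module.length_top]
  gcongr
  exact Module.length_le_of_injective (g.codRestrict _ hgh)
    fun x y hxy => hginj (congrArg Subtype.val hxy)

/-- Given P < Q in the support, a homogeneous element of degree a in Q outside P makes the length of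
(S/P)_n grow by at least one with each step n ↦ a + n, while the lengths of the M_n bound it. -/
theorem dimSuppPlusPlus_le_zero (hS : IsStandard 𝒮) [Module.Finite S M] (C : ℕ)
    (hC : ∀ᶠ n in Filter.atTop, Module.length A (ℳ n) ≤ C) : dimSuppPlusPlus 𝒮 M ≤ 0 := by
  rw [dimSuppPlusPlus, Order.krullDim_nonpos_iff_forall_isMax]
  rintro ⟨P, hP⟩ ⟨Q, hQ⟩ hPQ
  rw [mem_suppPlusPlus_iff] at hP hQ
  change P.asIdeal ≤ Q.asIdeal at hPQ
  change Q.asIdeal ≤ P.asIdeal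
  by_contra hlt
  obtain ⟨q, hqQ, hqP⟩ := SetLike.not_le_iff_exists.1 hlt
  obtain ⟨a, ha⟩ : ∃ a, comp 𝒮 a q ∉ P.asIdeal := by
    by_contra! h
    exact hqP (mem_of_comp_mem 𝒮 (N := P.asIdeal.toAddSubmonoid) h)
  obtain ⟨s, deg, hs⟩ := exists_length_quotient_le (𝒮 := 𝒮) ℳ
  obtain ⟨n₀, hn₀⟩ := Filter.eventually_atTop.1 hC
  have hbound : ∀ n, n₀ ≤ n →
      Module.length A (quotientGrading 𝒮 P.asIdeal n) ≤ ((s.card * C : ℕ) : ℕ∞) := by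
    intro n hn
    refine (hs _ hP.2 n).trans ((Finset.sum_le_card_nsmul _ _ _
      fun y _ => hn₀ _ (hn.trans le_self_add)).trans ?_)
    simp
  have hgrow : ∀ j : ℕ, (j : ℕ∞) ≤
      Module.length A (quotientGrading 𝒮 P.asIdeal (j • a + n₀)) := by
    intro j
    induction j with
    | zero => simp
    | succ j ih =>
      have h1 := length_quotient_add_le (𝒮 := 𝒮) (A := A) hPQ (comp_mem 𝒮 a q)
        (hQ.1.1 a hqQ) ha (j • a + n₀)
      rw [← add_assoc, add_comm a, ← succ_nsmul] at h1
      refine le_trans ?_ h1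
      push_cast
      exact add_le_add ih (one_le_length_quotient hS hQ.1 _)
  have := (hgrow (s.card * C + 1)).trans (hbound _ le_add_self)
  exact absurd (Nat.cast_le.1 this) (by omega)

theorem suppPlusPlus_eq_empty_iff [IsNoetherianRing S] (hS : IsStandard 𝒮) [Module.Finite S M] :
    suppPlusPlus 𝒮 M = ∅ ↔ ∀ᶠ n in Filter.atTop, ℳ n = ⊥ := by
  constructor
  · intro h
    refine eventually_eq_bot_of_forall_proj ℳ hS fun P hP hle => ?_
    exact Set.notMem_empty P (h ▸ mem_suppPlusPlus_iff.2 ⟨hP, hle⟩)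
  · intro h
    rw [Set.eq_empty_iff_forall_notMem]
    intro P hP
    rw [mem_suppPlusPlus_iff] at hP
    obtain ⟨s, deg, hs⟩ := exists_length_quotient_le (𝒮 := 𝒮) ℳ
    obtain ⟨n, hn⟩ := Filter.eventually_atTop.1 h
    have h1 := (one_le_length_quotient hS hP.1 n).trans (hs _ hP.2 n)
    rw [Finset.sum_eq_zero fun y _ => by
      rw [hn _ (le_self_add : n ≤ n + deg y), Module.length_bot]] at h1
    exact absurd h1 (by simp)

theorem dimSuppPlusPlus_eq_bot_iff [IsNoetherianRing S] (hS : IsStandard 𝒮) [Module.Finite S M] :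
    dimSuppPlusPlus 𝒮 M = ⊥ ↔ ∀ᶠ n in Filter.atTop, ℳ n = ⊥ := by
  rw [← suppPlusPlus_eq_empty_iff ℳ hS, dimSuppPlusPlus, Order.krullDim_eq_bot_iff,
    Set.isEmpty_coe_sort]

theorem dimSuppPlusPlus_eq_zero_of_le_of_ne_bot {N : Type*} [AddCommGroup N] [Module S N]
    (h : dimSuppPlusPlus 𝒮 N ≤ 0) (hne : dimSuppPlusPlus 𝒮 N ≠ ⊥) : dimSuppPlusPlus 𝒮 N = 0 := by
  refine le_antisymm h (Order.krullDim_nonneg_iff.2 ?_)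
  rw [← not_isEmpty_iff, ← Order.krullDim_eq_bot_iff]
  exact hne

/-- For a module with eventually constant Hilbert function. -/
theorem dimSuppPlusPlus_of_hasExpansion_single [IsArtinianRing A] [IsNoetherianRing S]
    (hS : IsStandard 𝒮) [Module.Finite S M] {c : ℤ}
    (h : HasExpansion ℳ (Finsupp.single 0 c)) :
    0 ≤ c ∧ dimSuppPlusPlus 𝒮 M ≤ 0 ∧ (dimSuppPlusPlus 𝒮 M = 0 ↔ 0 < c) := by
  have hc : ∀ᶠ n in Filter.atTop, hilb ℳ n = c := by
    filter_upwards [h] with n hn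
    rw [hn, binomSum_single, binomVal_zero, mul_one]
  have hc0 : 0 ≤ c := by
    obtain ⟨n, hn⟩ := hc.exists
    rw [← hn]
    exact Int.natCast_nonneg _
  have hle : dimSuppPlusPlus 𝒮 M ≤ 0 := by
    refine dimSuppPlusPlus_le_zero ℳ hS c.toNat ?_
    filter_upwards [hc] with n hn
    rw [← hn, hilb, Int.toNat_natCast, ENat.natCast_toNat (length_ne_top ℳ hS n)]
  have hbot : dimSuppPlusPlus 𝒮 M = ⊥ ↔ c = 0 := by
    rw [dimSuppPlusPlus_eq_bot_iff ℳ hS]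
    constructor
    · intro h0
      obtain ⟨n, hn, hn'⟩ := (hc.and h0).exists
      rw [← hn, hilb_eq_zero hn']
    · rintro rfl
      filter_upwards [hc] with n hn
      have h0 : (Module.length A (ℳ n)).toNat = 0 := by
        unfold hilb at hn
        exact_mod_cast hn
      rw [ENat.toNat_eq_zero, or_iff_left (length_ne_top ℳ hS n),
        Module.length_eq_zero_iff] at h0
      exact Submodule.subsingleton_iff_eq_bot.1 h0
  refine ⟨hc0, hle, fun h0 => ?_, fun hpos => ?_⟩
  · refine lt_of_le_of_ne hc0 fun hc' => ?_
    rw [hbot.2 hc'.symm] at h0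
    exact absurd h0 (by simp)
  · exact dimSuppPlusPlus_eq_zero_of_le_of_ne_bot hle fun h0 => hpos.ne' (hbot.1 h0)

end Dimension

end MixedMult

/-! ### The four equivalent conditions. -/

theorem mainTheorem7 {d : ℕ} (hd : 0 < d)
    {A S M : Type*}
    [CommRing A] [IsArtinianRing A] [IsLocalRing A] [Infinite (IsLocalRing.ResidueField A)]
    [CommRing S] [Algebra A S]
    (𝒮 : (Fin d → ℕ) → Submodule A S) [GradedAlgebra 𝒮] (hS : MixedMult.IsStandard 𝒮)
    [AddCommGroup M] [Module A M] [Module S M] [IsScalarTower A S M] [Module.Finite S M]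
    (ℳ : (Fin d → ℕ) → Submodule A M) [DirectSum.Decomposition ℳ] [SetLike.GradedSMul 𝒮 ℳ]
    (k : Fin d → ℕ) (hk : MixedMult.IsMixedMultiplicity ℳ k) :
    List.TFAE [
      0 < MixedMult.hilbertCoeff ℳ k,
      ∀ (t : ℕ) (x : Fin t → S), MixedMult.IsMixedMultiplicitySystem 𝒮 M x k →
        MixedMult.dimSuppPlusPlus 𝒮 (MixedMult.ModSeq M x) = 0,
      ∀ (t : ℕ) (x : Fin t → S), MixedMult.IsOfType 𝒮 x k →
        MixedMult.IsFilterRegularSequence ℳ x →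
        MixedMult.dimSuppPlusPlus 𝒮 (MixedMult.ModSeq M x) = 0,
      ∃ (t : ℕ) (x : Fin t → S), MixedMult.IsOfType 𝒮 x k ∧
        MixedMult.IsFilterRegularSequence ℳ x ∧
        MixedMult.dimSuppPlusPlus 𝒮 (MixedMult.ModSeq M x) = 0] := by
  open MixedMult in
  have := hS.1
  have : IsNoetherianRing S := Algebra.FiniteType.isNoetherianRing A S
  obtain ⟨e, he⟩ := exists_hasExpansion ℳ hS
  have hcoeff : hilbertCoeff ℳ = e := hilbertCoeff_eq (length_ne_top ℳ hS) he
  rw [IsMixedMultiplicity, hcoeff] at hk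
  rw [hcoeff]
  -- For h ≠ 0 the index h + k exceeds k, where the coefficients vanish by hypothesis.
  have hshift : shift k e = Finsupp.single 0 (e k) := by
    ext h
    rw [shift_apply, Finsupp.single_apply]
    split_ifs with h0
    · rw [← h0, zero_add]
    · refine hk _ (lt_of_le_of_ne le_add_self fun hkh => h0 ?_)
      simpa [eq_comm] using hkh
  have hfilter : ∀ (t : ℕ) (x : Fin t → S), IsOfType 𝒮 x k → IsFilterRegularSequence ℳ x →
      0 ≤ e k ∧ dimSuppPlusPlus 𝒮 (ModSeq M x) ≤ 0 ∧
        (dimSuppPlusPlus 𝒮 (ModSeq M x) = 0 ↔ 0 < e k) := by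
    rintro t x ⟨c, hx, hc⟩ hreg
    have h := hasExpansion_quotient_of_isFilterRegularSequence ℳ hS he hx hreg
    rw [sum_single_eq_of_card_eq hc, hshift] at h
    have hhom := isHomogeneous_span_image_smul_top ℳ hx Set.univ
    rw [Set.image_univ] at hhom
    let := quotientDecomposition hhom
    exact dimSuppPlusPlus_of_hasExpansion_single _ hS h
  tfae_have 1 → 2 := by
    rintro hpos t x ⟨⟨c, hx, hc⟩, hle⟩
    refine dimSuppPlusPlus_eq_zero_of_le_of_ne_bot hle fun hbot => ?_
    rw [dimSuppPlusPlus, Order.krullDim_eq_bot_iff, Set.isEmpty_coe_sort,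
      Set.eq_empty_iff_forall_notMem] at hbot
    -- Empty support of M/𝐱M says that no relevant prime contains both the annihilator of M and 𝐱.
    have h0 := shift_eq_zero_of_forall_proj hS t c x hx M ℳ (fun P hP hle hall => by
      refine hbot P ⟨hP, ?_⟩
      rw [Module.support_quotient, Module.support_eq_zeroLocus, PrimeSpectrum.zeroLocus_span]
      refine ⟨hle, ?_⟩
      rintro _ ⟨j, rfl⟩
      exact hall j) e he
    rw [sum_single_eq_of_card_eq hc, hshift, Finsupp.single_eq_zero] at h0
    exact hpos.ne' h0
  tfae_have 2 → 3 := fun h t x hx hreg => h t x ⟨hx, (hfilter t x hx hreg).2.1⟩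
  tfae_have 3 → 4 := by
    intro h
    obtain ⟨t, c, hc⟩ := exists_card_fiber_eq k
    obtain ⟨x, hx, hreg⟩ := exists_isFilterRegularSequence ℳ hS t c
    exact ⟨t, x, ⟨c, hx, hc⟩, hreg, h t x ⟨c, hx, hc⟩ hreg⟩
  tfae_have 4 → 1 := by
    rintro ⟨t, x, hx, hreg, h0⟩
    exact (hfilter t x hx hreg).2.2.1 h0
  tfae_finish
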